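/- Let $\sigma>0$ and $V>0$ be fixed. For $n\ge 1$ and a score vector $R\in\mathbb{R}^n$, let $\pi^\star$ be a true ranking of $R$, i.e. a permutation of $1,\dots,n$ with $R_{\pi^\star(1)}\ge R_{\pi^\star(2)}\ge\cdots\ge R_{\pi^\star(n)}$ (if $R$ has ties, any such permutation may be chosen), and let $$V(R)=\sum_{i=1}^{n-1}\bigl|R_{\pi^\star(i+1)}-R_{\pi^\star(i)}\bigr|=\max_i R_i-\min_i R_i .$$ One observes raw scores $y_i=R_i+z_i$, $i=1,\dots,n$, where $z_1,\dots,z_n$ are independent $\mathcal{N}(0,\sigma^2)$ random variables. Given a ranking $\pi$, the Isotonic Mechanism reports $\widehat R(\pi)$, the unique minimizer of $\tfrac12\|y-r\|^2$ (Euclidean norm) over all $r\in\mathbb{R}^n$ with $r_{\pi(1)}\ge r_{\pi(2)}\ge\cdots\ge r_{\pi(n)}$. Then the squared error $\sum_{i=1}^n(\widehat R_i(\pi^\star)-R_i)^2$ is integrable for every $R$, its expectation is bounded over all $R$ with $V(R)\le V$, and $$0.4096+o_n(1)\;\le\;\frac{\sup_{R\in\mathbb{R}^n:\,V(R)\le V}\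 \mathbb{E}\Bigl[\sum_{i=1}^n\bigl(\widehat R_i(\pi^\star)-R_i\bigr)^2\Bigr]}{n^{1/3}\,\sigma^{4/3}\,V^{2/3}}\;\le\;7.5625+o_n(1),$$ where both $o_n(1)$ terms depend only on $n$, $\sigma$ and $V$ and tend to $0$ as $n\to\infty$. -/

import Mathlib

open MeasureTheory ProbabilityTheory Filter Topology

noncomputable section

namespace IsotonicMechanism

/-- `π` is a true ranking of the scores `R`: `R (π 1) ≥ R (π 2) ≥ ⋯ ≥ R (π n)`. -/
def IsTrueRanking {n : ℕ} (π : Equiv.Perm (Fin n)) (R : EuclideanSpace ℝ (Fin n)) : Prop :=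
  ∀ i j : Fin n, i ≤ j → R (π j) ≤ R (π i)

theorem exists_isTrueRanking {n : ℕ} (R : EuclideanSpace ℝ (Fin n)) :
    ∃ π : Equiv.Perm (Fin n), IsTrueRanking π R := by
  refine ⟨Tuple.sort (fun i => -R i), fun i j hij => ?_⟩
  have h := Tuple.monotone_sort (fun i => -R i) hij
  simp only [Function.comp_apply] at h
  linarith

/-- The feasible set `{r : r (π 1) ≥ r (π 2) ≥ ⋯ ≥ r (π n)}`. -/
def isotonicCone {n : ℕ} (π : Equiv.Perm (Fin n)) : Set (EuclideanSpace ℝ (Fin n)) :=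
  {r | ∀ i j : Fin n, i ≤ j → r (π j) ≤ r (π i)}

/-- `r` is an optimal solution of: minimize `‖y - r‖² / 2` over the isotonic cone of `π`. -/
def IsOptimal {n : ℕ} (π : Equiv.Perm (Fin n)) (y r : EuclideanSpace ℝ (Fin n)) : Prop :=
  r ∈ isotonicCone π ∧ ∀ s ∈ isotonicCone π, (1 / 2 : ℝ) * ‖y - r‖ ^ 2 ≤ (1 / 2) * ‖y - s‖ ^ 2

theorem isClosed_isotonicCone {n : ℕ} (π : Equiv.Perm (Fin n)) : IsClosed (isotonicCone π) := by
  simp only [isotonicCone, Set.ofPred_forall]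
  refine isClosed_iInter fun i => isClosed_iInter fun j => isClosed_iInter fun _ => ?_
  exact isClosed_le (by fun_prop) (by fun_prop)

theorem convex_isotonicCone {n : ℕ} (π : Equiv.Perm (Fin n)) : Convex ℝ (isotonicCone π) := by
  intro x hx y hy a b ha hb _ i j hij
  have h1 := mul_le_mul_of_nonneg_left (hx i j hij) ha
  have h2 := mul_le_mul_of_nonneg_left (hy i j hij) hb
  simp only [PiLp.add_apply, PiLp.smul_apply, smul_eq_mul]
  linarith

theorem exists_isOptimal {n : ℕ} (π : Equiv.Perm (Fin n)) (y : EuclideanSpace ℝ (Fin n)) :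
    ∃ r, IsOptimal π y r := by
  have hne : (isotonicCone π).Nonempty := ⟨0, fun i j _ => by simp⟩
  obtain ⟨r, hr, h⟩ := exists_norm_eq_iInf_of_complete_convex hne
    (isClosed_isotonicCone π).isComplete (convex_isotonicCone π) y
  refine ⟨r, hr, fun s hs => ?_⟩
  have hle : ‖y - r‖ ≤ ‖y - s‖ := by
    rw [h]
    exact ciInf_le ⟨0, by rintro _ ⟨w, rfl⟩; exact norm_nonneg _⟩ (⟨s, hs⟩ : isotonicCone π)
  gcongr

theorem IsOptimal.unique {n : ℕ} {π : Equiv.Perm (Fin n)} {y r s : EuclideanSpace ℝ (Fin n)}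
    (hr : IsOptimal π y r) (hs : IsOptimal π y s) : r = s := by
  have hm := convex_isotonicCone π hr.1 hs.1 (a := 1 / 2) (b := 1 / 2)
    (by norm_num) (by norm_num) (by norm_num)
  have h1 := hr.2 _ hm
  have h2 := hs.2 _ hr.1
  have h3 := hr.2 _ hs.1
  have hp := parallelogram_law_with_norm ℝ (y - r) (y - s)
  have e1 : (y - r) + (y - s) = (2 : ℝ) • (y - ((1 / 2 : ℝ) • r + (1 / 2 : ℝ) • s)) := by
    module
  have e2 : (y - r) - (y - s) = s - r := by abel
  rw [e1, e2, norm_smul, Real.norm_ofNat] at hp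
  have h0 : ‖s - r‖ = 0 := by nlinarith [norm_nonneg (s - r)]
  exact (sub_eq_zero.mp (norm_eq_zero.mp h0)).symm

/-- The output `R̂(π)` of the Isotonic Mechanism on the raw scores `y`: the (unique) optimal
solution of the convex program. -/
def isotonicMechanism {n : ℕ} (π : Equiv.Perm (Fin n)) (y : EuclideanSpace ℝ (Fin n)) :
    EuclideanSpace ℝ (Fin n) :=
  (exists_isOptimal π y).choose

theorem isotonicMechanism_isOptimal {n : ℕ} (π : Equiv.Perm (Fin n))
    (y : EuclideanSpace ℝ (Fin n)) : IsOptimal π y (isotonicMechanism π y) :=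
  (exists_isOptimal π y).choose_spec

/-- The total variation `∑_{i=1}^{n-1} |R (π (i+1)) - R (π i)|` of `R` along the ranking `π`. -/
def totalVariation {n : ℕ} (π : Equiv.Perm (Fin n)) (R : EuclideanSpace ℝ (Fin n)) : ℝ :=
  ∑ i : Fin (n - 1),
    |R (π ⟨i.val + 1, by have := i.isLt; omega⟩) - R (π ⟨i.val, by have := i.isLt; omega⟩)|

/-- Along a true ranking, the total variation is the range of the scores. -/
theorem totalVariation_eq {n : ℕ} {π : Equiv.Perm (Fin n)} {R : EuclideanSpace ℝ (Fin n)}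
    (h : IsTrueRanking π R) : totalVariation π R = (⨆ i, R i) - ⨅ i, R i := by
  rcases n with _ | m
  · simp [totalVariation]
  · have hmax : (⨆ i, R i) = R (π 0) := by
      apply le_antisymm
      · refine ciSup_le fun i => ?_
        have := h 0 (π.symm i) (Fin.zero_le _)
        simpa using this
      · exact le_ciSup (f := fun i => R i) (Set.finite_range _).bddAbove (π 0)
    have hmin : (⨅ i, R i) = R (π (Fin.last m)) := by
      apply le_antisymm
      · exact ciInf_le (f := fun i => R i) (Set.finite_range _).bddBelow (π (Fin.last m))
      · refine le_ciInf fun i => ?_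
        have := h (π.symm i) (Fin.last m) (Fin.le_last _)
        simpa using this
    let f : ℕ → ℝ := fun k => if hk : k < m + 1 then R (π ⟨k, hk⟩) else 0
    have hsum : totalVariation π R = ∑ k ∈ Finset.range m, (f k - f (k + 1)) := by
      rw [Finset.sum_range]
      refine Finset.sum_congr rfl fun i _ => ?_
      have hi : i.val < m := i.isLt
      have hle := h ⟨i.val, by omega⟩ ⟨i.val + 1, by omega⟩ (by simp [Fin.le_def])
      simp only [f]
      rw [dif_pos (by omega), dif_pos (by omega), abs_of_nonpos (by linarith)]
      ring
    rw [hsum, Finset.sum_range_sub', hmax, hmin]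
    simp [f, Fin.last]

/-- The raw scores `y i = R i + z i`. -/
def rawScores {n : ℕ} {Ω : Type*} (z : Fin n → Ω → ℝ) (R : EuclideanSpace ℝ (Fin n)) (ω : Ω) :
    EuclideanSpace ℝ (Fin n) :=
  WithLp.toLp 2 fun i => R i + z i ω

/-- The squared error `∑ i, (R̂(π) i - R i)²` of the mechanism, as a random variable. -/
def squaredError {n : ℕ} {Ω : Type*} (z : Fin n → Ω → ℝ) (π : Equiv.Perm (Fin n))
    (R : EuclideanSpace ℝ (Fin n)) (ω : Ω) : ℝ :=
  ∑ i, (isotonicMechanism π (rawScores z R ω) i - R i) ^ 2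

/-- The worst-case risk over scores of total variation at most `V`, where `πstar R` is the
true ranking reported when the true scores are `R`. -/
def worstCaseRisk {n : ℕ} {Ω : Type*} [MeasurableSpace Ω] (P : Measure Ω) (z : Fin n → Ω → ℝ)
    (πstar : EuclideanSpace ℝ (Fin n) → Equiv.Perm (Fin n)) (V : ℝ) : ℝ :=
  ⨆ R : {R : EuclideanSpace ℝ (Fin n) // totalVariation (πstar R) R ≤ V},
    ∫ ω, squaredError z (πstar R) R ω ∂P

end IsotonicMechanism

end

/-! After sorting coordinates by the true ranking and dividing the noise by `σ`, the mechanism is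
the metric projection onto the cone of nonincreasing vectors, and the error is `‖dev‖²` under a
standard Gaussian. The rate comes from `n σ = V x³`: windows of length about `x²` balance bias
against noise, and `σ V x` is the normalization `n^{1/3} σ^{4/3} V^{2/3}`.

Upper bound. The isotonic fit at `i` is at most the data average over some window starting at any
prescribed `u ≤ i` and ending at some `v ≥ i` (`exists_card_mul_fit_le`). Scores to the right of `i`
only lower this average, and the noise averages over `[u, v]`, `v ≥ i`, form a reversed martingale
whose maximum is controlled by reflection (`posMax_sq`). Hence the root mean square of the positive
error at `i` is at most bias plus `1/√M`, for every available window length `M`. The best `M`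
depends on `i`, but `sq_le_of_le_bias_add_knot` replaces the optimization by a bound linear in the
biases. These sum over `i` to at most `V M (M - 1) / 2`, independently of the shape of `R`. Negative
errors follow by reversing and negating. The result is `risk_le`, with leading constant 6.

Lower bound. The expected gain, the mean over `z` of the maximum over `θ` of `⟪z, θ - R⟫ - ‖θ - R‖²
/ (2u)`, is concave in `u` with derivative `risk / (2u²)`, so a lower bound on its increment above
`σ` bounds the risk at `σ` from below (`IsModel.meanGain_le_add_risk`). Let `c` be the supremum over
all configurations of gain divided by `(n u V²)^{1/3}`. It is finite (`Achieves.le_bound`), and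
scaling, repeating coordinates and stacking blocks carry a near-optimal configuration to every large
`n` (`Achieves.eventually`). Choose `R` nearly attaining `c` at level `1.02³ σ`. At level `σ` its
gain cannot exceed `c` times the normalization, so the increment is about `0.02 c`
(`eventually_le_risk`). No knowledge of `R` is needed, only a lower bound on `c`. That bound comes
from step functions around a constant vector, where the gain contains the maximum of a Gaussian
random walk, estimated by Spitzer's argument (`achieves_large`). -/

noncomputable section

namespace IsotonicMechanism

open scoped RealInnerProductSpace

/-! ### Projections onto convex sets and the penalized gain -/

section Projection

variable {H : Type*} [NormedAddCommGroup H] [InnerProductSpace ℝ H]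

/-- `p` is the metric projection of `y` onto the convex set `C`. -/
def IsProj (C : Set H) (y p : H) : Prop := p ∈ C ∧ ∀ w ∈ C, ⟪y - p, w - p⟫ ≤ 0

/-- `C` is a closed convex model containing the true parameter `R`. -/
structure IsModel (C : Set H) (R : H) : Prop where
  closed : IsClosed C
  convex : Convex ℝ C
  mem : R ∈ C

theorem IsProj.norm_sub_le {C : Set H} {y y' p p' : H} (h : IsProj C y p) (h' : IsProj C y' p') :
    ‖p - p'‖ ≤ ‖y - y'‖ := by
  have h1 := h.2 p' h'.1
  have h2 := h'.2 p h.1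
  have h3 : ‖p - p'‖ ^ 2 ≤ ⟪y - y', p - p'⟫ := by
    rw [← real_inner_self_eq_norm_sq]
    have e1 : ⟪y - p, p' - p⟫ = - ⟪y - p, p - p'⟫ := by rw [← inner_neg_right, neg_sub]
    have e2 : ⟪y - y', p - p'⟫ = ⟪y - p, p - p'⟫ - ⟪y' - p', p - p'⟫ + ⟪p - p', p - p'⟫ := by
      simp only [inner_sub_left]; ring
    linarith
  have h4 := real_inner_le_norm (y - y') (p - p')
  by_contra hcon
  push Not at hcon
  have : 0 < ‖p - p'‖ := lt_of_le_of_lt (norm_nonneg _) hcon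
  nlinarith

theorem IsProj.unique {C : Set H} {y p p' : H} (h : IsProj C y p) (h' : IsProj C y p') :
    p = p' := by
  have := h.norm_sub_le h'
  rw [sub_self, norm_zero] at this
  exact sub_eq_zero.mp (norm_eq_zero.mp (le_antisymm this (norm_nonneg _)))

theorem IsModel.exists_isProj [CompleteSpace H] {C : Set H} {R : H} (h : IsModel C R) (y : H) :
    ∃ p, IsProj C y p := by
  obtain ⟨p, hp, hmin⟩ := exists_norm_eq_iInf_of_complete_convex ⟨R, h.mem⟩
    h.closed.isComplete h.convex y
  exact ⟨p, hp, (norm_eq_iInf_iff_real_inner_le_zero h.convex hp).1 hmin⟩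

/-- The metric projection onto `C`. -/
def proj (C : Set H) (y : H) : H := Classical.epsilon (IsProj C y)

/-- The deviation from `R` of the least squares estimator over `C` at noise level `u`. -/
def dev (C : Set H) (R : H) (u : ℝ) (z : H) : H := proj C (R + u • z) - R

/-- The optimal value of `⟪z, θ - R⟫ - ‖θ - R‖² / (2u)` over `θ ∈ C`. -/
def gain (C : Set H) (R : H) (u : ℝ) (z : H) : ℝ :=
  ⟪z, dev C R u z⟫ - ‖dev C R u z‖ ^ 2 / (2 * u)

theorem inner_sub_sq_le {u : ℝ} (hu : 0 < u) (z e : H) :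
    ⟪z, e⟫ - ‖e‖ ^ 2 / (2 * u) ≤ u / 2 * ‖z‖ ^ 2 := by
  have h1 := real_inner_le_norm z e
  have h2 : ‖z‖ * ‖e‖ ≤ u / 2 * ‖z‖ ^ 2 + ‖e‖ ^ 2 / (2 * u) := by
    have key : u / 2 * ‖z‖ ^ 2 + ‖e‖ ^ 2 / (2 * u) - ‖z‖ * ‖e‖ = (u * ‖z‖ - ‖e‖) ^ 2 / (2 * u) := by
      field_simp; ring
    have : 0 ≤ (u * ‖z‖ - ‖e‖) ^ 2 / (2 * u) := by positivity
    linarith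
  linarith

theorem gain_le {C : Set H} {R : H} {u : ℝ} (hu : 0 < u) (z : H) :
    gain C R u z ≤ u / 2 * ‖z‖ ^ 2 := inner_sub_sq_le hu z _

variable [CompleteSpace H] {C C' : Set H} {R : H} {u v : ℝ}

theorem IsModel.isProj_proj (h : IsModel C R) (y : H) : IsProj C y (proj C y) :=
  Classical.epsilon_spec (h.exists_isProj y)

theorem IsModel.add_dev_mem (h : IsModel C R) (u : ℝ) (z : H) : R + dev C R u z ∈ C := by
  rw [dev, add_sub_cancel]; exact (h.isProj_proj _).1

theorem IsModel.inner_dev_le (h : IsModel C R) (hu : 0 < u) (z : H) {θ : H} (hθ : θ ∈ C) :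
    ⟪z, θ - R⟫ - ⟪dev C R u z, θ - R⟫ / u
      ≤ ⟪z, dev C R u z⟫ - ‖dev C R u z‖ ^ 2 / u := by
  have h1 := (h.isProj_proj (R + u • z)).2 θ hθ
  have e1 : R + u • z - proj C (R + u • z) = u • z - dev C R u z := by rw [dev]; abel
  have e2 : θ - proj C (R + u • z) = (θ - R) - dev C R u z := by rw [dev]; abel
  rw [e1, e2] at h1
  generalize dev C R u z = d at *
  simp only [inner_sub_left, inner_sub_right, real_inner_smul_left, real_inner_self_eq_norm_sq] at *
  have h2 : u * (⟪z, θ⟫ - ⟪z, R⟫ - (⟪d, θ⟫ - ⟪d, R⟫) / u) ≤ u * (⟪z, d⟫ - ‖d‖ ^ 2 / u) := by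
    field_simp
    linarith
  exact le_of_mul_le_mul_left h2 hu

/-- The tangent inequality: `u ↦ gain C R u z` is concave with derivative `‖dev‖² / (2u²)`. -/
theorem IsModel.le_gain_add (h : IsModel C R) (hu : 0 < u) (hv : 0 < v) (z : H) {θ : H}
    (hθ : θ ∈ C) :
    ⟪z, θ - R⟫ - ‖θ - R‖ ^ 2 / (2 * v) ≤
      gain C R u z + (v - u) * (‖dev C R u z‖ ^ 2 / (2 * u ^ 2)) := by
  have h1 := h.inner_dev_le hu z hθ
  rw [gain]
  generalize dev C R u z = d at *
  have h2 := real_inner_le_norm d (θ - R)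
  generalize θ - R = e at *
  -- Young's inequality, with equality when `u ‖e‖ = v ‖d‖`. This is what lets the optimizer at
  -- level `u` bound every competitor at level `v`.
  have h3 : ‖d‖ * ‖e‖ / u ≤ ‖e‖ ^ 2 / (2 * v) + v * ‖d‖ ^ 2 / (2 * u ^ 2) := by
    rw [div_add_div _ _ (by positivity) (by positivity), div_le_div_iff₀ (by positivity) (by positivity)]
    nlinarith [mul_nonneg hu.le (sq_nonneg (u * ‖e‖ - v * ‖d‖))]
  have h4 : ⟪d, e⟫ / u ≤ ‖d‖ * ‖e‖ / u := by gcongr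
  have h5 : (v - u) * (‖d‖ ^ 2 / (2 * u ^ 2)) = v * ‖d‖ ^ 2 / (2 * u ^ 2) - ‖d‖ ^ 2 / (2 * u) := by
    field_simp
  have h6 : ‖d‖ ^ 2 / u = 2 * (‖d‖ ^ 2 / (2 * u)) := by field_simp
  linarith

theorem IsModel.le_gain (h : IsModel C R) (hu : 0 < u) (z : H) {θ : H} (hθ : θ ∈ C) :
    ⟪z, θ - R⟫ - ‖θ - R‖ ^ 2 / (2 * u) ≤ gain C R u z := by
  simpa using h.le_gain_add hu hu z hθ

theorem IsModel.exists_gain_eq (h : IsModel C R) (u : ℝ) (z : H) :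
    ∃ θ ∈ C, gain C R u z = ⟪z, θ - R⟫ - ‖θ - R‖ ^ 2 / (2 * u) :=
  ⟨_, h.add_dev_mem u z, by simp [gain]⟩

theorem IsModel.gain_le_gain_add (h : IsModel C R) (hu : 0 < u) (hv : 0 < v) (z : H) :
    gain C R v z ≤ gain C R u z + (v - u) * (‖dev C R u z‖ ^ 2 / (2 * u ^ 2)) := by
  obtain ⟨θ, hθ, e⟩ := h.exists_gain_eq v z
  rw [e]; exact h.le_gain_add hu hv z hθ

theorem IsModel.gain_mono_level (h : IsModel C R) (hu : 0 < u) (huv : u ≤ v) (z : H) :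
    gain C R u z ≤ gain C R v z := by
  obtain ⟨θ, hθ, e⟩ := h.exists_gain_eq u z
  rw [e]
  refine le_trans ?_ (h.le_gain (hu.trans_le huv) z hθ)
  gcongr

theorem IsModel.gain_mono_set (h : IsModel C R) (h' : IsModel C' R) (hC : C ⊆ C') (hu : 0 < u)
    (z : H) : gain C R u z ≤ gain C' R u z := by
  obtain ⟨θ, hθ, e⟩ := h.exists_gain_eq u z
  rw [e]; exact h'.le_gain hu z (hC hθ)

theorem IsModel.gain_nonneg (h : IsModel C R) (hu : 0 < u) (z : H) : 0 ≤ gain C R u z := by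
  simpa using h.le_gain hu z h.mem

theorem IsModel.dev_zero (h : IsModel C R) (u : ℝ) : dev C R u 0 = 0 := by
  have : IsProj C (R + u • (0 : H)) R := ⟨h.mem, by simp⟩
  rw [dev, (h.isProj_proj _).unique this, sub_self]

theorem IsModel.norm_dev_sub_le (h : IsModel C R) (hu : 0 ≤ u) (z z' : H) :
    ‖dev C R u z - dev C R u z'‖ ≤ u * ‖z - z'‖ := by
  have := (h.isProj_proj (R + u • z)).norm_sub_le (h.isProj_proj (R + u • z'))
  rw [add_sub_add_left_eq_sub, ← smul_sub, norm_smul, Real.norm_of_nonneg hu] at this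
  simpa [dev] using this

theorem IsModel.norm_dev_le (h : IsModel C R) (hu : 0 ≤ u) (z : H) :
    ‖dev C R u z‖ ≤ u * ‖z‖ := by
  simpa [h.dev_zero] using h.norm_dev_sub_le hu z 0

theorem IsModel.continuous_dev (h : IsModel C R) (hu : 0 ≤ u) : Continuous (dev C R u) := by
  refine (LipschitzWith.of_dist_le_mul (K := ⟨u, hu⟩) fun z z' => ?_).continuous
  rw [dist_eq_norm, dist_eq_norm]
  exact h.norm_dev_sub_le hu z z'

theorem IsModel.continuous_gain (h : IsModel C R) (hu : 0 ≤ u) : Continuous (gain C R u) := by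
  have := h.continuous_dev hu
  unfold gain
  fun_prop

end Projection

/-! ### Mean gain and risk under the standard Gaussian measure -/

section Gaussian

variable {H H' : Type*} [NormedAddCommGroup H] [InnerProductSpace ℝ H] [FiniteDimensional ℝ H]
  [MeasurableSpace H] [BorelSpace H] [NormedAddCommGroup H'] [InnerProductSpace ℝ H']
  [FiniteDimensional ℝ H'] [MeasurableSpace H'] [BorelSpace H']

/-- The adjoint of a linear isometry preserves standard Gaussian measures. -/
theorem stdGaussian_map_adjoint (f : H' →ₗᵢ[ℝ] H) :
    (stdGaussian H).map (ContinuousLinearMap.adjoint f.toContinuousLinearMap) =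
      stdGaussian H' := by
  apply Measure.ext_of_charFun
  ext t
  rw [charFun_stdGaussian, charFun_apply, integral_map (by fun_prop) (by fun_prop)]
  simp_rw [ContinuousLinearMap.adjoint_inner_left]
  rw [← charFun_apply, charFun_stdGaussian]
  simp

theorem measurePreserving_adjoint (f : H' →ₗᵢ[ℝ] H) :
    MeasurePreserving (ContinuousLinearMap.adjoint f.toContinuousLinearMap)
      (stdGaussian H) (stdGaussian H') :=
  ⟨by fun_prop, stdGaussian_map_adjoint f⟩

theorem measurePreserving_isometryEquiv (f : H ≃ₗᵢ[ℝ] H') :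
    MeasurePreserving f (stdGaussian H) (stdGaussian H') :=
  ⟨by fun_prop, stdGaussian_map f⟩

theorem memLp_inner_stdGaussian (a : H) : MemLp (fun z => ⟪a, z⟫) 2 (stdGaussian H) :=
  IsGaussian.memLp_dual (stdGaussian H) (innerSL ℝ a) 2 (by simp)

theorem integrable_inner_stdGaussian (a : H) : Integrable (fun z => ⟪a, z⟫) (stdGaussian H) :=
  (memLp_inner_stdGaussian a).integrable (by norm_num)

theorem integral_inner_stdGaussian (a : H) : ∫ z, ⟪a, z⟫ ∂(stdGaussian H) = 0 :=
  integral_strongDual_stdGaussian (innerSL ℝ a)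

theorem integral_inner_sq_stdGaussian (a : H) :
    ∫ z, ⟪a, z⟫ ^ 2 ∂(stdGaussian H) = ‖a‖ ^ 2 := by
  have h := variance_dual_stdGaussian (E := H) (innerSL ℝ a)
  rw [variance_of_integral_eq_zero (by fun_prop) (integral_strongDual_stdGaussian _),
    innerSL_apply_norm] at h
  exact h

theorem map_inner_stdGaussian (a : H) :
    (stdGaussian H).map (fun z => ⟪a, z⟫) = gaussianReal 0 (‖a‖₊ ^ 2) := by
  have h := IsGaussian.map_eq_gaussianReal (μ := stdGaussian H) (innerSL ℝ a)
  rw [integral_strongDual_stdGaussian, variance_dual_stdGaussian, innerSL_apply_norm] at h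
  rwa [Real.toNNReal_pow (norm_nonneg a), norm_toNNReal] at h

theorem memLp_id_stdGaussian : MemLp (fun z : H => z) 2 (stdGaussian H) :=
  IsGaussian.memLp_two_id

theorem integrable_norm_sq_stdGaussian : Integrable (fun z : H => ‖z‖ ^ 2) (stdGaussian H) :=
  (memLp_two_iff_integrable_sq_norm (by fun_prop)).1 memLp_id_stdGaussian

theorem integral_norm_sq_stdGaussian :
    ∫ z : H, ‖z‖ ^ 2 ∂(stdGaussian H) = Module.finrank ℝ H := by
  have e : ∀ z : H, ‖z‖ ^ 2 = ∑ i, ⟪stdOrthonormalBasis ℝ H i, z⟫ ^ 2 := fun z =>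
    ((stdOrthonormalBasis ℝ H).sum_sq_inner_right z).symm
  simp_rw [e]
  rw [integral_finsetSum _ fun i _ => (memLp_inner_stdGaussian _).integrable_sq]
  simp [integral_inner_sq_stdGaussian]

variable {C C' : Set H} {R : H} {u v : ℝ}

/-- The expected gain of the model `C` at `R` with noise level `u`. -/
def meanGain (C : Set H) (R : H) (u : ℝ) : ℝ := ∫ z, gain C R u z ∂(stdGaussian H)

/-- The risk of the least squares estimator over `C` at `R` with noise level `u`. -/
def risk (C : Set H) (R : H) (u : ℝ) : ℝ := ∫ z, ‖dev C R u z‖ ^ 2 ∂(stdGaussian H)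

theorem IsModel.integrable_gain (h : IsModel C R) (hu : 0 < u) :
    Integrable (gain C R u) (stdGaussian H) := by
  refine (integrable_norm_sq_stdGaussian.const_mul (u / 2)).mono'
    (h.continuous_gain hu.le).aestronglyMeasurable (ae_of_all _ fun z => ?_)
  rw [Real.norm_of_nonneg (h.gain_nonneg hu z)]
  exact gain_le hu z

theorem IsModel.integrable_dev_sq (h : IsModel C R) (hu : 0 ≤ u) :
    Integrable (fun z => ‖dev C R u z‖ ^ 2) (stdGaussian H) := by
  have hc := h.continuous_dev hu
  refine (integrable_norm_sq_stdGaussian.const_mul (u ^ 2)).mono'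
    (by fun_prop) (ae_of_all _ fun z => ?_)
  rw [Real.norm_of_nonneg (by positivity), ← mul_pow]
  exact pow_le_pow_left₀ (norm_nonneg _) (h.norm_dev_le hu z) 2

theorem IsModel.meanGain_le (h : IsModel C R) (hu : 0 < u) :
    meanGain C R u ≤ u / 2 * Module.finrank ℝ H := by
  rw [← integral_norm_sq_stdGaussian, ← integral_const_mul]
  exact integral_mono (h.integrable_gain hu) (integrable_norm_sq_stdGaussian.const_mul _)
    fun z => gain_le hu z

theorem IsModel.risk_le_finrank (h : IsModel C R) (hu : 0 ≤ u) :
    risk C R u ≤ u ^ 2 * Module.finrank ℝ H := by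
  rw [← integral_norm_sq_stdGaussian, ← integral_const_mul]
  refine integral_mono (h.integrable_dev_sq hu) (integrable_norm_sq_stdGaussian.const_mul _)
    fun z => ?_
  rw [← mul_pow]
  exact pow_le_pow_left₀ (norm_nonneg _) (h.norm_dev_le hu z) 2

theorem IsModel.meanGain_le_add_risk (h : IsModel C R) (hu : 0 < u) (hv : 0 < v) :
    meanGain C R v ≤ meanGain C R u + (v - u) / (2 * u ^ 2) * risk C R u := by
  rw [meanGain, meanGain, risk, ← integral_const_mul,
    ← integral_add (h.integrable_gain hu) ((h.integrable_dev_sq hu.le).const_mul _)]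
  refine integral_mono (h.integrable_gain hv)
    ((h.integrable_gain hu).add ((h.integrable_dev_sq hu.le).const_mul _)) fun z => ?_
  refine (h.gain_le_gain_add hu hv z).trans_eq ?_
  ring

theorem IsModel.meanGain_mono_level (h : IsModel C R) (hu : 0 < u) (huv : u ≤ v) :
    meanGain C R u ≤ meanGain C R v :=
  integral_mono (h.integrable_gain hu) (h.integrable_gain (hu.trans_le huv))
    fun z => h.gain_mono_level hu huv z

theorem IsModel.meanGain_mono_set (h : IsModel C R) (h' : IsModel C' R) (hC : C ⊆ C')
    (hu : 0 < u) : meanGain C R u ≤ meanGain C' R u :=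
  integral_mono (h.integrable_gain hu) (h'.integrable_gain hu)
    fun z => h.gain_mono_set h' hC hu z

/-- Comparison of a model with orthogonal scaled copies of a smaller one inside it. -/
theorem card_mul_meanGain_le {J : Type*} [Fintype J] {D : Set H'} {S : H'} (hS : IsModel D S)
    (hR : IsModel C R) (ι : J → H' →ₗᵢ[ℝ] H)
    (horth : ∀ i j, i ≠ j → ∀ s t, ⟪ι i s, ι j t⟫ = 0) {ρ : ℝ} (hρ : 0 < ρ)
    (hmem : ∀ θ : J → H', (∀ j, θ j ∈ D) → R + ρ • ∑ j, ι j (θ j - S) ∈ C) (hu : 0 < u) :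
    ρ * Fintype.card J * meanGain D S u ≤ meanGain C R (ρ * u) := by
  have hpath : ∀ z, ∑ j, ρ * gain D S u
      (ContinuousLinearMap.adjoint (ι j).toContinuousLinearMap z) ≤ gain C R (ρ * u) z := by
    intro z
    choose θ hθ hgain using fun j => hS.exists_gain_eq u
      (ContinuousLinearMap.adjoint (ι j).toContinuousLinearMap z)
    -- The separate optimizers, assembled, form one competitor in `C`. Orthogonality makes its
    -- squared norm additive, and each adjoint image of the noise is again standard Gaussian.
    refine le_of_eq_of_le ?_ (hR.le_gain (mul_pos hρ hu) z (hmem θ hθ))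
    have hn : ‖∑ j, ι j (θ j - S)‖ ^ 2 = ∑ j, ‖θ j - S‖ ^ 2 := by
      rw [← real_inner_self_eq_norm_sq, sum_inner]
      refine Finset.sum_congr rfl fun i _ => ?_
      rw [inner_sum, Finset.sum_eq_single i (fun j _ hj => horth i j hj.symm _ _) (by simp),
        real_inner_self_eq_norm_sq, LinearIsometry.norm_map]
    rw [add_sub_cancel_left, norm_smul, mul_pow, hn, real_inner_smul_right, inner_sum,
      Real.norm_of_nonneg hρ.le, Finset.mul_sum, Finset.mul_sum, Finset.sum_div,
      ← Finset.sum_sub_distrib]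
    refine Finset.sum_congr rfl fun j _ => ?_
    rw [hgain j, ContinuousLinearMap.adjoint_inner_left]
    simp only [LinearIsometry.coe_toContinuousLinearMap]
    field_simp
  have hinteg : ∀ j, Integrable (fun z => gain D S u
      (ContinuousLinearMap.adjoint (ι j).toContinuousLinearMap z)) (stdGaussian H) := fun j =>
    (measurePreserving_adjoint (ι j)).integrable_comp_of_integrable (hS.integrable_gain hu)
  have hval : ∀ j, ∫ z, gain D S u
      (ContinuousLinearMap.adjoint (ι j).toContinuousLinearMap z) ∂(stdGaussian H) =
        meanGain D S u := fun j => by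
    rw [meanGain, ← stdGaussian_map_adjoint (ι j), integral_map (by fun_prop)
      (hS.continuous_gain hu.le).aestronglyMeasurable]
  calc ρ * Fintype.card J * meanGain D S u
      = ∫ z, ∑ j, ρ * gain D S u
          (ContinuousLinearMap.adjoint (ι j).toContinuousLinearMap z) ∂(stdGaussian H) := by
        rw [integral_finsetSum _ fun j _ => (hinteg j).const_mul ρ]
        simp_rw [integral_const_mul, hval]
        simp; ring
    _ ≤ _ := integral_mono (integrable_finsetSum _ fun j _ => (hinteg j).const_mul ρ)
        (hR.integrable_gain (mul_pos hρ hu)) hpath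

end Gaussian

/-! ### Maximal inequality for reversed Gaussian martingales -/

section Maximal

variable {H : Type*} [NormedAddCommGroup H] [InnerProductSpace ℝ H]
  {ι : Type*} [LinearOrder ι] [Fintype ι]

/-- The running maximum of the positive parts of the projections `⟪t v, z⟫`, `v ≥ i`. -/
def posMax (t : ι → H) (i : ι) (z : H) : ℝ :=
  (Finset.univ.filter (i ≤ ·)).sup' ⟨i, by simp⟩ fun v => max ⟪t v, z⟫ 0

theorem continuous_posMax (t : ι → H) (i : ι) : Continuous (posMax t i) :=
  Continuous.finset_sup'_apply _ fun v _ => by fun_prop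

theorem le_posMax (t : ι → H) {i v : ι} (h : i ≤ v) (z : H) : ⟪t v, z⟫ ≤ posMax t i z :=
  (le_max_left _ 0).trans (Finset.le_sup' (fun v => max ⟪t v, z⟫ 0) (by simpa using h))

theorem posMax_nonneg (t : ι → H) (i : ι) (z : H) : 0 ≤ posMax t i z :=
  (le_max_right ⟪t i, z⟫ 0).trans
    (Finset.le_sup' (fun v => max ⟪t v, z⟫ 0) (by simp))

variable [FiniteDimensional ℝ H] [MeasurableSpace H] [BorelSpace H]

/-- Lévy's maximal inequality for a reversed Gaussian martingale. -/
theorem measure_exists_lt_inner_le (t : ι → H) (i : ι)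
    (ht : ∀ v w, i ≤ v → v ≤ w → ⟪t i - t v, t w⟫ = 0) (x : ℝ) :
    stdGaussian H {z | ∃ v, i ≤ v ∧ x < ⟪t v, z⟫} ≤ 2 * stdGaussian H {z | x < ⟪t i, z⟫} := by
  classical
  set μ := stdGaussian H
  -- `v` is the last index above level `x`. As the martingale runs backwards, this is its first
  -- passage.
  let A : ι → Set H := fun v => {z | x < ⟪t v, z⟫ ∧ ∀ w, v < w → ⟪t w, z⟫ ≤ x}
  let F : Set H := {z | x < ⟪t i, z⟫}
  have hF : MeasurableSet F := measurableSet_lt (by fun_prop) (by fun_prop)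
  have hA : ∀ v, MeasurableSet (A v) := fun v => by
    have : A v = {z | x < ⟪t v, z⟫} ∩ ⋂ w, ⋂ (_ : v < w), {z | ⟪t w, z⟫ ≤ x} := by
      ext z; simp [A]
    rw [this]
    exact (measurableSet_lt (by fun_prop) (by fun_prop)).inter
      (MeasurableSet.iInter fun w => MeasurableSet.iInter fun _ =>
        measurableSet_le (by fun_prop) (by fun_prop))
  have hcover : {z | ∃ v, i ≤ v ∧ x < ⟪t v, z⟫} ⊆ ⋃ v ∈ Finset.univ.filter (i ≤ ·), A v := by
    rintro z ⟨v, hv, hxv⟩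
    obtain ⟨m, hm⟩ := (Finset.univ.filter fun w => x < ⟪t w, z⟫).exists_maximal
      ⟨v, by simpa using hxv⟩
    simp only [Finset.mem_filter, Finset.mem_univ, true_and, Set.mem_iUnion]
    have hm1 : x < ⟪t m, z⟫ := by simpa using hm.1
    refine ⟨m, ?_, hm1, fun w hw => ?_⟩
    · by_contra hlt
      push Not at hlt
      exact absurd (hm.2 (by simpa using hxv) (hlt.le.trans hv)) (not_le.2 (hlt.trans_le hv))
    · by_contra hlt
      push Not at hlt
      exact absurd (hm.2 (by simpa using hlt) hw.le) (not_le.2 hw)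
  have hrefl : ∀ v, i ≤ v → μ (A v ∩ Fᶜ) ≤ μ (A v ∩ F) := by
    intro v hv
    -- The reflection negating `a` fixes every `t w` with `w ≥ v`, hence preserves `A v`, and sends
    -- `⟪t i, z⟫` to `2 ⟪t v, z⟫ - ⟪t i, z⟫`. The latter exceeds `x` on `A v` whenever `⟪t i, z⟫ ≤
    -- x`.
    let a := t i - t v
    let ρ : H ≃ₗᵢ[ℝ] H := (ℝ ∙ a)ᗮ.reflection
    have hρ : ∀ b z : H, ⟪b, ρ z⟫ = ⟪ρ b, z⟫ := fun b z => by
      rw [← ρ.inner_map_map b (ρ z)]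
      simp [ρ]
    have hfix : ∀ w, v ≤ w → ρ (t w) = t w := fun w hw => by
      apply Submodule.reflection_mem_subspace_eq_self
      rw [Submodule.mem_orthogonal_singleton_iff_inner_right]
      exact ht v w hv hw
    have hneg : ρ a = -a := Submodule.reflection_orthogonalComplement_singleton_eq_neg a
    have hti : ∀ z, ⟪t i, ρ z⟫ = 2 * ⟪t v, z⟫ - ⟪t i, z⟫ := fun z => by
      have e : t i = a + t v := by simp [a]
      rw [hρ, e, map_add, hneg, hfix v le_rfl]
      simp only [inner_add_left, inner_neg_left]
      ring
    rw [← (measurePreserving_isometryEquiv ρ).measure_preimage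
      ((hA v).inter hF).nullMeasurableSet]
    refine measure_mono fun z hz => ?_
    obtain ⟨⟨h1, h2⟩, h3⟩ := hz
    simp only [F, Set.mem_compl_iff, Set.mem_ofPred_eq, not_lt] at h3
    refine ⟨⟨?_, fun w hw => ?_⟩, ?_⟩
    · rw [hρ, hfix v le_rfl]; exact h1
    · rw [hρ, hfix w hw.le]; exact h2 w hw
    · change x < ⟪t i, ρ z⟫
      rw [hti]; linarith
  have hdisj : Set.PairwiseDisjoint (↑(Finset.univ.filter (i ≤ ·))) fun v => A v ∩ F := by
    intro v _ w _ hvw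
    refine Set.disjoint_left.2 fun z hz hz' => ?_
    rcases lt_or_gt_of_ne hvw with h | h
    · exact absurd (hz.1.2 w h) (not_le.2 hz'.1.1)
    · exact absurd (hz'.1.2 v h) (not_le.2 hz.1.1)
  calc μ {z | ∃ v, i ≤ v ∧ x < ⟪t v, z⟫}
      ≤ ∑ v ∈ Finset.univ.filter (i ≤ ·), μ (A v) :=
        (measure_mono hcover).trans (measure_biUnion_finset_le _ _)
    _ ≤ ∑ v ∈ Finset.univ.filter (i ≤ ·), 2 * μ (A v ∩ F) := by
        refine Finset.sum_le_sum fun v hv => ?_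
        rw [← measure_inter_add_sdiff (A v) hF, two_mul, Set.sdiff_eq]
        exact add_le_add le_rfl (hrefl v (by simpa using hv))
    _ = 2 * μ (⋃ v ∈ Finset.univ.filter (i ≤ ·), A v ∩ F) := by
        rw [measure_biUnion_finset hdisj fun v _ => (hA v).inter hF, Finset.mul_sum]
    _ ≤ 2 * μ F := by
        gcongr
        exact Set.iUnion₂_subset fun v _ => Set.inter_subset_right

theorem integral_max_inner_sq (a : H) :
    ∫ z, max ⟪a, z⟫ 0 ^ 2 ∂(stdGaussian H) = ‖a‖ ^ 2 / 2 := by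
  have hinteg : ∀ b : H, Integrable (fun z => max ⟪b, z⟫ 0 ^ 2) (stdGaussian H) := fun b => by
    refine ((memLp_inner_stdGaussian b).integrable_sq).mono' (by fun_prop)
      (ae_of_all _ fun z => ?_)
    rw [Real.norm_of_nonneg (by positivity)]
    rcases le_total ⟪b, z⟫ 0 with h | h <;> simp [h, sq_nonneg]
  have hsymm : ∫ z, max ⟪-a, z⟫ 0 ^ 2 ∂(stdGaussian H) = ∫ z, max ⟪a, z⟫ 0 ^ 2 ∂(stdGaussian H) := by
    rw [← (measurePreserving_isometryEquiv (LinearIsometryEquiv.neg ℝ (E := H))).integral_comp'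
      (f := (LinearIsometryEquiv.neg ℝ (E := H)).toHomeomorph.toMeasurableEquiv)]
    simp
  have hsum := integral_add (hinteg a) (hinteg (-a))
  rw [hsymm] at hsum
  have e : ∀ z : H, max ⟪a, z⟫ 0 ^ 2 + max ⟪-a, z⟫ 0 ^ 2 = ⟪a, z⟫ ^ 2 := fun z => by
    rw [inner_neg_left]
    rcases le_total ⟪a, z⟫ 0 with h | h
    · rw [max_eq_right h, max_eq_left (by linarith)]; ring
    · rw [max_eq_left h, max_eq_right (by linarith)]; ring
  simp_rw [e, integral_inner_sq_stdGaussian] at hsum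
  linarith

/-- Integrating the tail inequality by layer cake costs a factor 2, which cancels the `1/2` in
`integral_max_inner_sq`. The maximum over all `v ≥ i` thus costs no more than the full second moment
at `i`. -/
theorem posMax_sq (t : ι → H) (i : ι)
    (ht : ∀ v w, i ≤ v → v ≤ w → ⟪t i - t v, t w⟫ = 0) :
    Integrable (fun z => posMax t i z ^ 2) (stdGaussian H) ∧
      ∫ z, posMax t i z ^ 2 ∂(stdGaussian H) ≤ ‖t i‖ ^ 2 := by
  have hc := continuous_posMax t i
  have hle : ∫⁻ z, ENNReal.ofReal (posMax t i z ^ 2) ∂(stdGaussian H) ≤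
      ENNReal.ofReal (‖t i‖ ^ 2) := by
    have h1 := lintegral_rpow_eq_lintegral_meas_lt_mul (stdGaussian H)
      (ae_of_all _ (posMax_nonneg t i)) hc.aemeasurable (p := 2) (by norm_num)
    have h2 := lintegral_rpow_eq_lintegral_meas_lt_mul (stdGaussian H)
      (f := fun z => max ⟪t i, z⟫ 0) (ae_of_all _ fun z => le_max_right _ _) (by fun_prop)
      (p := 2) (by norm_num)
    simp only [Real.rpow_ofNat] at h1 h2
    have h3 : ∫⁻ z, ENNReal.ofReal (max ⟪t i, z⟫ 0 ^ 2) ∂(stdGaussian H) =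
        ENNReal.ofReal (‖t i‖ ^ 2 / 2) := by
      rw [← integral_max_inner_sq, ofReal_integral_eq_lintegral_ofReal]
      · refine ((memLp_inner_stdGaussian (t i)).integrable_sq).mono' (by fun_prop)
          (ae_of_all _ fun z => ?_)
        rw [Real.norm_of_nonneg (by positivity)]
        rcases le_total ⟪t i, z⟫ 0 with h | h <;> simp [h, sq_nonneg]
      · exact ae_of_all _ fun z => by positivity
    have h4 : ENNReal.ofReal (‖t i‖ ^ 2) = 2 * ENNReal.ofReal (‖t i‖ ^ 2 / 2) := by
      rw [← ENNReal.ofReal_ofNat, ← ENNReal.ofReal_mul (by norm_num)]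
      congr 1; ring
    rw [h4, ← h3, h1, h2, mul_left_comm]
    gcongr
    rw [← lintegral_const_mul' _ _ (by simp)]
    refine setLIntegral_mono' measurableSet_Ioi fun x hx => ?_
    rw [← mul_assoc]
    gcongr
    have e1 : {z | x < posMax t i z} ⊆ {z | ∃ v, i ≤ v ∧ x < ⟪t v, z⟫} := by
      intro z hz
      obtain ⟨v, hv, hxv⟩ := (Finset.lt_sup'_iff _).1 (show x < posMax t i z from hz)
      refine ⟨v, by simpa using hv, ?_⟩
      rcases lt_max_iff.1 hxv with h | h
      · exact h
      · exact absurd h (not_lt.2 (le_of_lt hx))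
    have e2 : {z | x < ⟪t i, z⟫} ⊆ {z | x < max ⟪t i, z⟫ 0} := fun z hz =>
      show x < max ⟪t i, z⟫ 0 from lt_max_of_lt_left hz
    exact (measure_mono e1).trans ((measure_exists_lt_inner_le t i ht x).trans
      (mul_le_mul_right (measure_mono e2) _))
  have hinteg : Integrable (fun z => posMax t i z ^ 2) (stdGaussian H) := by
    refine ⟨(by fun_prop), ?_⟩
    rw [hasFiniteIntegral_iff_ofReal (ae_of_all _ fun z => by positivity)]
    exact hle.trans_lt ENNReal.ofReal_lt_top
  refine ⟨hinteg, ?_⟩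
  rw [integral_eq_lintegral_of_nonneg_ae (ae_of_all _ fun z => by positivity) (by fun_prop)]
  exact ENNReal.toReal_le_of_le_ofReal (by positivity) hle

end Maximal

/-! ### Linearizing the choice of window length -/

section Weights

/-- The standard deviation `1 / √k` of the average of `k` standard Gaussians. -/
def knot (k : ℕ) : ℝ := 1 / √k

theorem knot_nonneg (k : ℕ) : 0 ≤ knot k := by unfold knot; positivity

theorem knot_sq (k : ℕ) : knot k ^ 2 = 1 / k := by
  rw [knot, div_pow, Real.sq_sqrt (by positivity), one_pow]

theorem knot_anti {a b : ℕ} (ha : 1 ≤ a) (hab : a ≤ b) : knot b ≤ knot a := by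
  have : (0 : ℝ) < a := by exact_mod_cast ha
  unfold knot
  gcongr

theorem knot_succ_le (k : ℕ) : knot (k + 1) ≤ 2 * (√(k + 1 : ℕ) - √k) := by
  have h1 : 0 < √((k + 1 : ℕ) : ℝ) := Real.sqrt_pos.2 (by positivity)
  have h2 := Real.sq_sqrt (show (0 : ℝ) ≤ (k + 1 : ℕ) by positivity)
  have h3 := Real.sq_sqrt (show (0 : ℝ) ≤ (k : ℕ) by positivity)
  rw [knot, div_le_iff₀ h1]
  push_cast at *
  nlinarith [sq_nonneg (√((k : ℝ) + 1) - √(k : ℝ))]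

/-- Weights whose tail sums interpolate `q²` linearly between the knots `1 / √k`. -/
def knotWeight (N M : ℕ) : ℝ :=
  if M = N then knot (M - 1) + knot M else knot (M - 1) - knot (M + 1)

theorem knotWeight_nonneg {N M : ℕ} (hM : 2 ≤ M) : 0 ≤ knotWeight N M := by
  unfold knotWeight
  split_ifs
  · exact add_nonneg (knot_nonneg _) (knot_nonneg _)
  · exact sub_nonneg.2 (knot_anti (by omega) (by omega))

theorem sum_Icc_succ_left (f : ℕ → ℝ) {k N : ℕ} (h : k ≤ N) :
    ∑ M ∈ Finset.Icc k N, f M = f k + ∑ M ∈ Finset.Icc (k + 1) N, f M := by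
  rw [← Finset.insert_Icc_add_one_left_eq_Icc h, Finset.sum_insert (by simp)]

/-- The sum telescopes, the exceptional weight at `N` supplying the missing end. The value is the
slope of the chord of `q²` between the knots `k + 1` and `k`. -/
theorem sum_knotWeight {N k : ℕ} (hkN : k + 1 ≤ N) :
    ∑ M ∈ Finset.Icc (k + 1) N, knotWeight N M = knot k + knot (k + 1) := by
  refine Nat.decreasingInduction' (m := k + 1) (n := N)
    (P := fun j => ∑ M ∈ Finset.Icc j N, knotWeight N M = knot (j - 1) + knot j)
    (fun j hj _ ih => ?_) hkN ?_
  · rw [sum_Icc_succ_left _ hj.le, ih, knotWeight, if_neg hj.ne]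
    simp
  · simp [knotWeight]

/-- Up to the term `knot h ^ 2`, the right side is the chord of `q²` between two consecutive knots.
Capping the index at `h` lets a single family of weights serve positions with less room to their
left. -/
theorem sum_knotWeight_mul {N k h : ℕ} (hkh : k + 1 ≤ h) (hhN : h ≤ N) (q : ℝ) :
    ∑ M ∈ Finset.Icc (k + 1) N, knotWeight N M * (q - knot (min M h)) =
      (knot k + knot (k + 1)) * (q - knot (k + 1)) + knot (k + 1) ^ 2 - knot h ^ 2 := by
  refine Nat.decreasingInduction' (m := k + 1) (n := h)
    (P := fun j => ∑ M ∈ Finset.Icc j N, knotWeight N M * (q - knot (min M h)) =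
      (knot (j - 1) + knot j) * (q - knot j) + knot j ^ 2 - knot h ^ 2)
    (fun j hj _ ih => ?_) hkh ?_
  · rw [sum_Icc_succ_left _ (hj.le.trans hhN), ih, knotWeight, if_neg (by omega),
      min_eq_left hj.le]
    simp only [add_tsub_cancel_right]
    ring
  · obtain ⟨j, rfl⟩ : ∃ j, h = j + 1 := ⟨h - 1, by omega⟩
    rw [add_sub_cancel_right, Nat.add_sub_cancel, ← sum_knotWeight hhN, Finset.sum_mul]
    refine Finset.sum_congr rfl fun M hM => ?_
    rw [min_eq_right (Finset.mem_Icc.1 hM).1]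

/-- Summation by parts: the factor `M - 1` counts the tails starting at `j = 2, ..., M`, so the sum
equals that of the tail sums `knot (j - 1) + knot j`, and each knot is compared with an increment of
`2√j`. -/
theorem sum_knotWeight_mul_le (N : ℕ) :
    ∑ M ∈ Finset.Icc 2 N, knotWeight N M * ((M : ℝ) - 1) ≤ 4 * √N := by
  rcases Nat.lt_or_ge N 2 with hN | hN
  · rw [Finset.Icc_eq_empty (by omega)]; simp
  have key : ∑ M ∈ Finset.Icc 2 N, knotWeight N M * ((M : ℝ) - (2 : ℕ) + 1) ≤
      2 * (√N + √(N - 1 : ℕ) - √(2 - 1 : ℕ) - √(2 - 2 : ℕ)) := by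
    refine Nat.decreasingInduction' (m := 2) (n := N)
      (P := fun j => ∑ M ∈ Finset.Icc j N, knotWeight N M * ((M : ℝ) - j + 1) ≤
        2 * (√N + √(N - 1 : ℕ) - √(j - 1 : ℕ) - √(j - 2 : ℕ)))
      (fun j hj h2 ih => ?_) hN ?_
    · obtain ⟨k, rfl⟩ : ∃ k, j = k + 2 := ⟨j - 2, by omega⟩
      have e : ∑ M ∈ Finset.Icc (k + 2) N, knotWeight N M * ((M : ℝ) - (k + 2 : ℕ) + 1) =
          ∑ M ∈ Finset.Icc (k + 2) N, knotWeight N M +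
          ∑ M ∈ Finset.Icc (k + 2 + 1) N, knotWeight N M * ((M : ℝ) - (k + 2 + 1 : ℕ) + 1) := by
        have : ∑ M ∈ Finset.Icc (k + 2) N, knotWeight N M * ((M : ℝ) - (k + 2 : ℕ) + 1) =
            ∑ M ∈ Finset.Icc (k + 2) N, knotWeight N M +
            ∑ M ∈ Finset.Icc (k + 2) N, knotWeight N M * ((M : ℝ) - (k + 2 : ℕ)) := by
          rw [← Finset.sum_add_distrib]
          exact Finset.sum_congr rfl fun M _ => by ring
        rw [this, sum_Icc_succ_left (fun M => knotWeight N M * ((M : ℝ) - (k + 2 : ℕ))) hj.le]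
        simp only [sub_self, mul_zero, zero_add]
        congr 1
        refine Finset.sum_congr rfl fun M _ => ?_
        push_cast; ring
      rw [e, sum_knotWeight hj.le]
      have h1 := knot_succ_le k
      have h2 := knot_succ_le (k + 1)
      have e1 : k + 2 + 1 - 1 = k + 1 + 1 := by omega
      have e2 : k + 2 + 1 - 2 = k + 1 := by omega
      have e3 : k + 2 - 1 = k + 1 := by omega
      have e4 : k + 2 - 2 = k := by omega
      rw [e1, e2] at ih
      rw [e3, e4]
      linarith
    · obtain ⟨k, rfl⟩ : ∃ k, N = k + 2 := ⟨N - 2, by omega⟩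
      have h1 := knot_succ_le k
      have h2 := knot_succ_le (k + 1)
      have e3 : k + 2 - 1 = k + 1 := by omega
      have e4 : k + 2 - 2 = k := by omega
      simp only [Finset.Icc_self, Finset.sum_singleton, knotWeight, if_true, e3, e4]
      linarith
  have hle : √((N - 1 : ℕ) : ℝ) ≤ √N := Real.sqrt_le_sqrt (by exact_mod_cast Nat.sub_le N 1)
  have h0 := Real.sqrt_nonneg ((2 - 1 : ℕ) : ℝ)
  have h0' := Real.sqrt_nonneg ((2 - 2 : ℕ) : ℝ)
  refine le_trans (le_of_eq (Finset.sum_congr rfl fun M _ => ?_)) (key.trans (by linarith))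
  push_cast; ring

/-- The best trade-off `e M + 1 / √M` between bias and standard deviation over the windows
`M ≤ h` is controlled linearly by the biases. -/
theorem sq_le_of_le_bias_add_knot {N h : ℕ} (hh : 1 ≤ h) (hhN : h ≤ N) (e : ℕ → ℝ) {q : ℝ}
    (hq0 : 0 ≤ q) (he1 : e 1 = 0) (he0 : ∀ M, 1 ≤ M → 0 ≤ e M)
    (hmono : ∀ M, h ≤ M → e h ≤ e M)
    (hq : ∀ M, 1 ≤ M → M ≤ h → q ≤ e M + knot M) :
    q ^ 2 ≤ 1 / h + ∑ M ∈ Finset.Icc 2 N, knotWeight N M * e M := by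
  have hpos : 0 ≤ ∑ M ∈ Finset.Icc 2 N, knotWeight N M * e M :=
    Finset.sum_nonneg fun M hM => mul_nonneg (knotWeight_nonneg (Finset.mem_Icc.1 hM).1)
      (he0 M (by have := (Finset.mem_Icc.1 hM).1; omega))
  rw [← knot_sq]
  by_cases hqh : q ≤ knot h
  · have := pow_le_pow_left₀ hq0 hqh 2
    linarith
  push Not at hqh
  have hq1 : q ≤ knot 1 := by simpa [he1] using hq 1 le_rfl hh
  obtain ⟨k, hk1, hkh, hka, hkb⟩ : ∃ k, 1 ≤ k ∧ k + 1 ≤ h ∧ knot (k + 1) ≤ q ∧ q ≤ knot k := by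
    have hex : ∃ j, 1 ≤ j ∧ knot j < q := ⟨h, hh, hqh⟩
    classical
    obtain ⟨hj1, hj2⟩ := Nat.find_spec hex
    have hne : Nat.find hex ≠ 1 := fun h1 => by rw [h1] at hj2; linarith
    refine ⟨Nat.find hex - 1, by omega, ?_, ?_, ?_⟩
    · have := Nat.find_min' hex ⟨hh, hqh⟩; omega
    · rw [Nat.sub_add_cancel hj1]; exact hj2.le
    · by_contra hlt
      push Not at hlt
      exact Nat.find_min hex (m := Nat.find hex - 1) (by omega) ⟨by omega, hlt⟩
  have hlow : ∑ M ∈ Finset.Icc (k + 1) N, knotWeight N M * (q - knot (min M h)) ≤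
      ∑ M ∈ Finset.Icc 2 N, knotWeight N M * e M := by
    refine le_trans (Finset.sum_le_sum (g := fun M => knotWeight N M * e M) fun M hM => ?_)
      (Finset.sum_le_sum_of_subset_of_nonneg (Finset.Icc_subset_Icc_left (by omega))
        fun M hM _ => mul_nonneg (knotWeight_nonneg (Finset.mem_Icc.1 hM).1)
          (he0 M (by have := (Finset.mem_Icc.1 hM).1; omega)))
    have hM' := Finset.mem_Icc.1 hM
    refine mul_le_mul_of_nonneg_left ?_ (knotWeight_nonneg (by omega))
    rcases le_total M h with hMh | hMh
    · rw [min_eq_left hMh]; linarith [hq M (by omega) hMh]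
    · rw [min_eq_right hMh]; linarith [hq h hh le_rfl, hmono M hMh]
  rw [sum_knotWeight_mul hkh hhN] at hlow
  -- Convexity: between two knots the parabola lies below its chord.
  nlinarith [mul_nonneg (sub_nonneg.2 hka) (sub_nonneg.2 hkb)]

end Weights

/-! ### Total bias of windows of a given length -/

section Bias

/-- The cumulated bias of the window of length `M` ending at `i`, for scores `r`. -/
def windowBias (r : ℕ → ℝ) (i M : ℕ) : ℝ := ∑ s ∈ Finset.range M, (r (i - s) - r i)

/-- Shifting a monotone sequence by one step changes its sum by a telescoping amount at most `V`, so
a shift by `s` costs at most `s V`. Truncated subtraction repeats the value `r 0` to the left of the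
origin. -/
theorem sum_windowBias_le {r : ℕ → ℝ} {V : ℝ} (hV : ∀ k, r 0 - r k ≤ V)
    (n M : ℕ) : ∑ i ∈ Finset.range n, windowBias r i M ≤ V * (M * (M - 1) / 2) := by
  have hV0 : 0 ≤ V := by simpa using hV 0
  have hshift : ∀ s : ℕ, ∑ i ∈ Finset.range n, (r (i - s) - r i) ≤ s * V := by
    intro s
    induction s with
    | zero => simp
    | succ s ih =>
      have hstep : ∑ i ∈ Finset.range n, (r (i - (s + 1)) - r (i - s)) ≤ V := by
        rcases n with _ | n
        · simpa using hV0
        · rw [Finset.sum_range_succ']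
          have : ∀ i, r (i + 1 - (s + 1)) - r (i + 1 - s) =
              (fun i => r (i - s)) i - (fun i => r (i - s)) (i + 1) := fun i => by
            simp
          simp_rw [this]
          rw [Finset.sum_range_sub']
          simpa using hV (n - s)
      have : ∑ i ∈ Finset.range n, (r (i - (s + 1)) - r i) =
          ∑ i ∈ Finset.range n, (r (i - (s + 1)) - r (i - s)) +
          ∑ i ∈ Finset.range n, (r (i - s) - r i) := by
        rw [← Finset.sum_add_distrib]
        exact Finset.sum_congr rfl fun i _ => by ring
      rw [this]; push_cast; linarith
  unfold windowBias
  rw [Finset.sum_comm]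
  refine (Finset.sum_le_sum fun s _ => hshift s).trans (le_of_eq ?_)
  induction M with
  | zero => simp
  | succ M ih => rw [Finset.sum_range_succ, ih]; push_cast; ring

theorem windowBias_nonneg {r : ℕ → ℝ} (hr : Antitone r) (i M : ℕ) : 0 ≤ windowBias r i M :=
  Finset.sum_nonneg fun s _ => sub_nonneg.2 (hr (Nat.sub_le i s))

theorem windowBias_div_mono {r : ℕ → ℝ} (hr : Antitone r) (i : ℕ) {h M : ℕ} (hh : 1 ≤ h)
    (hM : h ≤ M) : windowBias r i h / h ≤ windowBias r i M / M := by
  induction M, hM using Nat.le_induction with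
  | base => exact le_rfl
  | succ M hM ih =>
    refine ih.trans ?_
    have h0 : (0 : ℝ) < M := by exact_mod_cast (by omega : 0 < M)
    rw [div_le_div_iff₀ h0 (by positivity), windowBias, windowBias, Finset.sum_range_succ]
    have : ∑ s ∈ Finset.range M, (r (i - s) - r i) ≤ M * (r (i - M) - r i) := by
      refine (Finset.sum_le_card_nsmul _ _ (r (i - M) - r i) fun s hs => ?_).trans_eq (by simp)
      have := hr (show i - M ≤ i - s by have := Finset.mem_range.1 hs; omega)
      linarith
    push_cast
    nlinarith

/-- Positions within `N` of the left end have no room for a window of length `N`. They account for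
the harmonic sum, hence the logarithm. -/
theorem sum_one_div_min_le (n : ℕ) {N : ℕ} (hN : 1 ≤ N) :
    ∑ i ∈ Finset.range n, 1 / ((min N (i + 1) : ℕ) : ℝ) ≤ n / N + (1 + Real.log N) := by
  have h1 : ∀ i, 1 / ((min N (i + 1) : ℕ) : ℝ) ≤
      1 / (N : ℝ) + if i < N then 1 / ((i : ℝ) + 1) else 0 := by
    intro i
    split_ifs with h
    · rw [min_eq_right (by omega)]
      have : (0 : ℝ) ≤ 1 / N := by positivity
      push_cast; linarith
    · rw [min_eq_left (by omega)]; simp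
  refine (Finset.sum_le_sum fun i _ => h1 i).trans ?_
  rw [Finset.sum_add_distrib, Finset.sum_const, Finset.card_range, nsmul_eq_mul, mul_one_div,
    ← Finset.sum_filter]
  gcongr
  refine le_trans (Finset.sum_le_sum_of_subset_of_nonneg (t := Finset.range N) ?_ ?_) ?_
  · intro i hi; simpa using (Finset.mem_filter.1 hi).2
  · intro i _ _; positivity
  · have := harmonic_le_one_add_log N
    simpa [harmonic] using this

end Bias

/-! ### Overestimation by the isotonic fit -/

section Fit

variable {n : ℕ}

/-- The cone of nonincreasing vectors. -/
def antitoneCone (n : ℕ) : Set (EuclideanSpace ℝ (Fin n)) := {r | ∀ i j, i ≤ j → r j ≤ r i}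

theorem isModel_antitoneCone {R : EuclideanSpace ℝ (Fin n)} (hR : R ∈ antitoneCone n) :
    IsModel (antitoneCone n) R :=
  ⟨isClosed_isotonicCone 1, convex_isotonicCone 1, hR⟩

/-- An isotonic fit at `i` is at most the average of the data over some window `[u, v] ∋ i`. -/
theorem exists_card_mul_fit_le {y s : EuclideanSpace ℝ (Fin n)} (h : IsProj (antitoneCone n) y s)
    (u i : Fin n) :
    ∃ v, i ≤ v ∧ ((Finset.Icc u v).card : ℝ) * s i ≤ ∑ j ∈ Finset.Icc u v, y j := by
  -- `v` is the last index whose fitted value is not below that at `i`. A strict drop follows `v`,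
  -- so the fit can be lowered slightly on `[u, v]` without leaving the cone, and optimality makes
  -- the residuals there sum to a nonnegative number.
  obtain ⟨v, hv⟩ := (Finset.univ.filter fun j => s i ≤ s j).exists_maximal ⟨i, by simp⟩
  have hv1 : s i ≤ s v := by simpa using hv.1
  have hiv : i ≤ v := by
    by_contra hlt
    push Not at hlt
    exact absurd (hv.2 (by simp) hlt.le) (not_le.2 hlt)
  have hlt : ∀ j, v < j → s j < s i := fun j hj => by
    by_contra hle
    push Not at hle
    exact absurd (hv.2 (by simpa using hle) hj.le) (not_le.2 hj)
  obtain ⟨ε, hε, hgap⟩ : ∃ ε > 0, ∀ j, v < j → s j ≤ s i - ε := by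
    by_cases hn : v.val + 1 < n
    · refine ⟨s i - s ⟨v.val + 1, hn⟩, sub_pos.2 (hlt _ (Fin.lt_def.2 (by simp))), fun j hj => ?_⟩
      rw [sub_sub_cancel]
      exact h.1 _ _ (Fin.le_def.2 (by have := Fin.lt_def.1 hj; simpa using this))
    -- When `v` is the last coordinate nothing lies below it, and any `ε` will do.
    · exact ⟨1, one_pos, fun j hj => absurd (Fin.lt_def.1 hj) (by have := j.2; omega)⟩
  let w : EuclideanSpace ℝ (Fin n) :=
    WithLp.toLp 2 fun j => s j - if j ∈ Finset.Icc u v then ε else 0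
  have hw : w ∈ antitoneCone n := by
    intro a b hab
    have hs := h.1 a b hab
    simp only [w, Finset.mem_Icc]
    by_cases hb : u ≤ b ∧ b ≤ v
    · rw [if_pos hb]
      split_ifs <;> linarith
    · rw [if_neg hb]
      by_cases ha : u ≤ a ∧ a ≤ v
      · rw [if_pos ha]
        have hvb : v < b := by
          by_contra hcon
          push Not at hcon
          exact hb ⟨ha.1.trans hab, hcon⟩
        have h1 := hgap b hvb
        have h2 := h.1 a v ha.2
        linarith
      · rw [if_neg ha]; linarith
  have hin := h.2 w hw
  have hsum : ⟪y - s, w - s⟫ = -ε * ∑ j ∈ Finset.Icc u v, (y j - s j) := by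
    rw [PiLp.inner_apply, Finset.mul_sum, ← Finset.sum_filter_add_sum_filter_not Finset.univ
      (· ∈ Finset.Icc u v)]
    rw [Finset.sum_eq_zero (s := Finset.univ.filter (¬ · ∈ Finset.Icc u v)), add_zero,
      Finset.filter_mem_eq_inter, Finset.univ_inter]
    · refine Finset.sum_congr rfl fun j hj => ?_
      simp [w, -Finset.mem_Icc, hj]
    · intro j hj
      simp [w, -Finset.mem_Icc, (Finset.mem_filter.1 hj).2]
  rw [hsum] at hin
  have hnn : 0 ≤ ∑ j ∈ Finset.Icc u v, (y j - s j) := by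
    by_contra hneg
    push Not at hneg
    nlinarith
  refine ⟨v, hiv, ?_⟩
  rw [Finset.sum_sub_distrib, sub_nonneg] at hnn
  refine le_trans ?_ hnn
  rw [← nsmul_eq_mul]
  exact Finset.card_nsmul_le_sum _ _ _ fun j hj =>
    hv1.trans (h.1 j v (Finset.mem_Icc.1 hj).2)

/-- The vector representing the average over the window `[u, v]`. -/
def avgVec (u v : Fin n) : EuclideanSpace ℝ (Fin n) :=
  WithLp.toLp 2 fun j => if j ∈ Finset.Icc u v then 1 / ((Finset.Icc u v).card : ℝ) else 0

theorem inner_avgVec (u v : Fin n) (z : EuclideanSpace ℝ (Fin n)) :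
    ⟪avgVec u v, z⟫ = (∑ j ∈ Finset.Icc u v, z j) / (Finset.Icc u v).card := by
  simp only [PiLp.inner_apply, avgVec, Finset.sum_div]
  rw [← Finset.sum_filter_add_sum_filter_not Finset.univ (· ∈ Finset.Icc u v),
    Finset.sum_eq_zero (s := Finset.univ.filter (¬ · ∈ Finset.Icc u v)), add_zero,
    Finset.filter_mem_eq_inter, Finset.univ_inter]
  · refine Finset.sum_congr rfl fun j hj => ?_
    simp [-Finset.mem_Icc, hj, div_eq_mul_inv]
  · intro j hj
    simp [-Finset.mem_Icc, (Finset.mem_filter.1 hj).2]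

/-- The value is independent of `v`. This is the orthogonality that makes averages with a common
left end a reversed martingale. -/
theorem inner_avgVec_avgVec {u v w : Fin n} (huv : u ≤ v) (hvw : v ≤ w) :
    ⟪avgVec u v, avgVec u w⟫ = 1 / ((Finset.Icc u w).card : ℝ) := by
  rw [inner_avgVec]
  have hpos : ((Finset.Icc u v).card : ℝ) ≠ 0 := by
    exact_mod_cast (Finset.card_pos.2 ⟨u, by simpa using huv⟩).ne'
  have : ∑ j ∈ Finset.Icc u v, avgVec u w j =
      ∑ j ∈ Finset.Icc u v, 1 / ((Finset.Icc u w).card : ℝ) := by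
    refine Finset.sum_congr rfl fun j hj => ?_
    have : j ∈ Finset.Icc u w := Finset.Icc_subset_Icc_right hvw hj
    simp [avgVec, -Finset.mem_Icc, this]
  rw [this, Finset.sum_const, nsmul_eq_mul, mul_div_cancel_left₀ _ hpos]

/-- The scores `R` extended to all natural numbers by the last one. -/
def extend (R : EuclideanSpace ℝ (Fin n)) (k : ℕ) : ℝ :=
  if h : 0 < n then R ⟨min k (n - 1), by omega⟩ else 0

theorem extend_val (R : EuclideanSpace ℝ (Fin n)) (i : Fin n) : extend R i = R i := by
  have := i.2
  rw [extend, dif_pos (by omega)]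
  have e : (⟨min i.val (n - 1), by omega⟩ : Fin n) = i := Fin.ext (by simp only; omega)
  rw [e]

theorem antitone_extend {R : EuclideanSpace ℝ (Fin n)} (hR : R ∈ antitoneCone n) :
    Antitone (extend R) := by
  intro a b hab
  unfold extend
  split_ifs
  · exact hR _ _ (Fin.le_def.2 (min_le_min_right _ hab))
  · exact le_rfl

theorem sum_window_eq (R : EuclideanSpace ℝ (Fin n)) (i : Fin n) {M : ℕ} (hM : 1 ≤ M)
    (hMi : M ≤ i.val + 1) :
    ∑ j ∈ Finset.Icc ⟨i.val + 1 - M, by have := i.2; omega⟩ i, (R j - R i) =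
      windowBias (extend R) i M := by
  have := i.2
  unfold windowBias
  symm
  refine Finset.sum_bij' (fun s _ => ⟨i.val - s, by omega⟩) (fun j _ => i.val - j.val)
    ?_ ?_ ?_ ?_ ?_
  · intro s hs
    have := Finset.mem_range.1 hs
    simp only [Finset.mem_Icc, Fin.le_def]
    omega
  · intro j hj
    simp only [Finset.mem_Icc, Fin.le_def] at hj
    simp only [Finset.mem_range]
    omega
  · intro s hs
    have := Finset.mem_range.1 hs
    simp only
    omega
  · intro j hj
    simp only [Finset.mem_Icc, Fin.le_def] at hj
    refine Fin.ext ?_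
    simp only
    omega
  · intro s hs
    rw [extend_val, ← extend_val R ⟨i.val - s, by omega⟩]

/-- The window furnished by `exists_card_mul_fit_le` ends at an uncontrolled `v ≥ i`. Scores beyond
`i` contribute nonpositive bias and the window has at least `M` points, so the bias is at most that
of the window stopped at `i`. The noise is handled by a maximum over `v`. -/
theorem dev_le_bias_add_posMax {R : EuclideanSpace ℝ (Fin n)} (hR : R ∈ antitoneCone n)
    (z : EuclideanSpace ℝ (Fin n)) (i : Fin n) {M : ℕ} (hM : 1 ≤ M) (hMi : M ≤ i.val + 1) :
    dev (antitoneCone n) R 1 z i ≤ windowBias (extend R) i M / M +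
      posMax (avgVec ⟨i.val + 1 - M, by have := i.2; omega⟩) i z := by
  have hi := i.2
  set u : Fin n := ⟨i.val + 1 - M, by omega⟩ with hu
  have hui : u ≤ i := Fin.le_def.2 (by simp only [hu]; omega)
  obtain ⟨v, hiv, hv⟩ := exists_card_mul_fit_le
    ((isModel_antitoneCone hR).isProj_proj (R + (1 : ℝ) • z)) u i
  have hcM : (M : ℝ) ≤ (Finset.Icc u v).card := by
    have : M ≤ (Finset.Icc u v).card := by
      rw [Fin.card_Icc]; have := Fin.le_def.1 hiv; simp only [hu]; omega
    exact_mod_cast this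
  have hM0 : (0 : ℝ) < M := by exact_mod_cast hM
  have hc0 : (0 : ℝ) < (Finset.Icc u v).card := hM0.trans_le hcM
  have hsplit : ∑ j ∈ Finset.Icc u v, (R + (1 : ℝ) • z) j =
      ∑ j ∈ Finset.Icc u v, (R j - R i) + (Finset.Icc u v).card * R i +
        ∑ j ∈ Finset.Icc u v, z j := by
    rw [← nsmul_eq_mul, ← Finset.sum_const, ← Finset.sum_add_distrib, ← Finset.sum_add_distrib]
    exact Finset.sum_congr rfl fun j _ => by simp
  have hbias : ∑ j ∈ Finset.Icc u v, (R j - R i) ≤ windowBias (extend R) i M := by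
    rw [← sum_window_eq R i hM hMi, ← Finset.sum_filter_add_sum_filter_not _ (· ≤ i)]
    have h1 : ∑ j ∈ (Finset.Icc u v).filter (¬ · ≤ i), (R j - R i) ≤ 0 :=
      Finset.sum_nonpos fun j hj => by
        have := hR i j (le_of_not_ge (Finset.mem_filter.1 hj).2)
        linarith
    have h2 : (Finset.Icc u v).filter (· ≤ i) = Finset.Icc u i := by
      ext j
      simp only [Finset.mem_filter, Finset.mem_Icc]
      exact ⟨fun h => ⟨h.1.1, h.2⟩, fun h => ⟨⟨h.1, h.2.trans hiv⟩, h.2⟩⟩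
    rw [h2]
    linarith
  have hpm := le_posMax (avgVec u) hiv z
  rw [inner_avgVec, div_le_iff₀ hc0] at hpm
  have hwb := windowBias_nonneg (antitone_extend hR) i M
  have hdev : dev (antitoneCone n) R 1 z i =
      proj (antitoneCone n) (R + (1 : ℝ) • z) i - R i := rfl
  rw [hsplit] at hv
  have hle : windowBias (extend R) i M ≤ windowBias (extend R) i M / M * (Finset.Icc u v).card := by
    calc windowBias (extend R) i M = windowBias (extend R) i M / M * M := by field_simp
      _ ≤ _ := by gcongr
  rw [hdev]
  refine le_of_mul_le_mul_left ?_ hc0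
  nlinarith

theorem integral_pos_dev_sq_le {R : EuclideanSpace ℝ (Fin n)} (hR : R ∈ antitoneCone n)
    (i : Fin n) {M : ℕ} (hM : 1 ≤ M) (hMi : M ≤ i.val + 1) :
    ∫ z, max (dev (antitoneCone n) R 1 z i) 0 ^ 2 ∂(stdGaussian (EuclideanSpace ℝ (Fin n))) ≤
      (windowBias (extend R) i M / M + knot M) ^ 2 := by
  have hi := i.2
  set u : Fin n := ⟨i.val + 1 - M, by omega⟩ with hu
  have hui : u ≤ i := Fin.le_def.2 (by simp only [hu]; omega)
  obtain ⟨hinteg, hX⟩ := posMax_sq (avgVec u) i fun v w hv hw => by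
    rw [inner_sub_left, inner_avgVec_avgVec hui (hv.trans hw),
      inner_avgVec_avgVec (hui.trans hv) hw, sub_self]
  have hM0 : (0 : ℝ) < M := by exact_mod_cast hM
  have hcard : (Finset.Icc u i).card = M := by
    rw [Fin.card_Icc]; simp only [hu]; omega
  rw [← real_inner_self_eq_norm_sq, inner_avgVec_avgVec hui le_rfl, hcard] at hX
  set α := windowBias (extend R) i M / M
  have hα : 0 ≤ α := div_nonneg (windowBias_nonneg (antitone_extend hR) i M) hM0.le
  have hsM : 0 < √(M : ℝ) := Real.sqrt_pos.2 hM0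
  have hkM : knot M * √(M : ℝ) = 1 := by rw [knot]; field_simp
  have hpt : ∀ z, max (dev (antitoneCone n) R 1 z i) 0 ^ 2 ≤
      (α ^ 2 + α * knot M) + (1 + α * √(M : ℝ)) * posMax (avgVec u) i z ^ 2 := by
    intro z
    have h0 := posMax_nonneg (avgVec u) i z
    have h1 : max (dev (antitoneCone n) R 1 z i) 0 ≤ α + posMax (avgVec u) i z :=
      max_le (dev_le_bias_add_posMax hR z i hM hMi) (add_nonneg hα h0)
    refine (pow_le_pow_left₀ (le_max_right _ _) h1 2).trans ?_
    -- The arithmetic-geometric mean inequality reduces the cross term to the second moment and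
    -- loses nothing when that moment equals `1 / M`.
    have h2 : 2 * posMax (avgVec u) i z ≤ knot M + √(M : ℝ) * posMax (avgVec u) i z ^ 2 := by
      refine le_of_mul_le_mul_left ?_ hsM
      nlinarith [sq_nonneg (√(M : ℝ) * posMax (avgVec u) i z - 1)]
    nlinarith [mul_le_mul_of_nonneg_left h2 hα]
  have hmodel := isModel_antitoneCone hR
  have hcont := hmodel.continuous_dev zero_le_one
  have hrhs : Integrable (fun z => (α ^ 2 + α * knot M) +
      (1 + α * √(M : ℝ)) * posMax (avgVec u) i z ^ 2)
      (stdGaussian (EuclideanSpace ℝ (Fin n))) :=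
    (integrable_const _).add (hinteg.const_mul _)
  refine (integral_mono_of_nonneg (ae_of_all _ fun z => by positivity) hrhs
    (ae_of_all _ hpt)).trans ?_
  rw [integral_add (integrable_const _) (hinteg.const_mul _), integral_const_mul]
  simp only [integral_const, probReal_univ, one_smul]
  have hs2 : knot M ^ 2 = 1 / M := knot_sq M
  have h3 : (1 + α * √(M : ℝ)) * ∫ z, posMax (avgVec u) i z ^ 2
      ∂(stdGaussian (EuclideanSpace ℝ (Fin n))) ≤ (1 + α * √(M : ℝ)) * (1 / M) := by
    gcongr
  have h4 : √(M : ℝ) * (1 / M) = knot M := by rw [← hs2, sq, ← mul_assoc, mul_comm √_, hkM, one_mul]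
  nlinarith

/-- The part of the risk due to overestimation. -/
def posRisk (R : EuclideanSpace ℝ (Fin n)) : ℝ :=
  ∑ i, ∫ z, max (dev (antitoneCone n) R 1 z i) 0 ^ 2 ∂(stdGaussian (EuclideanSpace ℝ (Fin n)))

/-- The linearized bound at each `i`, with `h = min N (i + 1)`, can be summed over `i` first. The
average bias over windows of length `M` then totals at most `V (M - 1) / 2`, and the weights turn
this into `V / 2 * (4 * √N)`. -/
theorem posRisk_le {R : EuclideanSpace ℝ (Fin n)} (hR : R ∈ antitoneCone n) {V : ℝ}
    (hV : ∀ i j, R i - R j ≤ V) (hV0 : 0 ≤ V) {N : ℕ} (hN : 1 ≤ N) :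
    posRisk R ≤ n / N + (1 + Real.log N) + 2 * √N * V := by
  have hanti := antitone_extend hR
  have hone : ∀ i : Fin n, ∫ z, max (dev (antitoneCone n) R 1 z i) 0 ^ 2
      ∂(stdGaussian (EuclideanSpace ℝ (Fin n))) ≤ 1 / ((min N (i.val + 1) : ℕ) : ℝ) +
        ∑ M ∈ Finset.Icc 2 N, knotWeight N M * (windowBias (extend R) i M / M) := by
    intro i
    have hnn : 0 ≤ ∫ z, max (dev (antitoneCone n) R 1 z i) 0 ^ 2
      ∂(stdGaussian (EuclideanSpace ℝ (Fin n))) := integral_nonneg fun z => by positivity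
    rw [← Real.sq_sqrt hnn]
    refine sq_le_of_le_bias_add_knot (by omega) (min_le_left _ _)
      (fun M => windowBias (extend R) i M / M) (Real.sqrt_nonneg _) (by simp [windowBias])
      (fun M _ => div_nonneg (windowBias_nonneg hanti i M) (by positivity))
      (fun M hM => windowBias_div_mono hanti i (by omega) hM) fun M hM1 hM2 => ?_
    have h0 : 0 ≤ windowBias (extend R) i M / M + knot M :=
      add_nonneg (div_nonneg (windowBias_nonneg hanti i M) (by positivity)) (knot_nonneg M)
    rw [← Real.sqrt_sq h0]
    exact Real.sqrt_le_sqrt (integral_pos_dev_sq_le hR i hM1 (hM2.trans (min_le_right _ _)))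
  refine (Finset.sum_le_sum fun i _ => hone i).trans ?_
  rw [Finset.sum_add_distrib, Fin.sum_univ_eq_sum_range
    (fun i => 1 / ((min N (i + 1) : ℕ) : ℝ)) n]
  refine add_le_add (sum_one_div_min_le n hN) ?_
  rw [Finset.sum_comm]
  have hM : ∀ M ∈ Finset.Icc 2 N, ∑ i : Fin n, knotWeight N M * (windowBias (extend R) i M / M) ≤
      V / 2 * (knotWeight N M * ((M : ℝ) - 1)) := by
    intro M hM
    have hM2 := (Finset.mem_Icc.1 hM).1
    have hM0 : (0 : ℝ) < M := by exact_mod_cast (by omega : 0 < M)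
    rw [← Finset.mul_sum, ← Finset.sum_div,
      Fin.sum_univ_eq_sum_range (fun i => windowBias (extend R) i M) n]
    have hs : ∑ i ∈ Finset.range n, windowBias (extend R) i M ≤ V * (M * (M - 1) / 2) := by
      refine sum_windowBias_le (fun k => ?_) n M
      unfold extend
      split_ifs
      · exact hV _ _
      · simpa using hV0
    calc knotWeight N M * ((∑ i ∈ Finset.range n, windowBias (extend R) i M) / M)
        ≤ knotWeight N M * ((V * (M * (M - 1) / 2)) / M) := by
          have := knotWeight_nonneg (N := N) hM2
          gcongr
      _ = _ := by field_simp
  refine (Finset.sum_le_sum hM).trans ?_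
  rw [← Finset.mul_sum]
  have := mul_le_mul_of_nonneg_left (sum_knotWeight_mul_le N) (by positivity : 0 ≤ V / 2)
  linarith

end Fit

/-! ### Symmetry, scaling and the nonasymptotic risk bound -/

section UpperBound

variable {n : ℕ}

/-- The isometry `r ↦ -r ∘ rev`, which preserves nonincreasing vectors. -/
def negRev (n : ℕ) : EuclideanSpace ℝ (Fin n) ≃ₗᵢ[ℝ] EuclideanSpace ℝ (Fin n) :=
  (LinearIsometryEquiv.piLpCongrLeft 2 ℝ ℝ Fin.revPerm).trans (LinearIsometryEquiv.neg ℝ)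

theorem negRev_apply (r : EuclideanSpace ℝ (Fin n)) (i : Fin n) :
    negRev n r i = -r (Fin.rev i) := by
  simp [negRev, LinearIsometryEquiv.piLpCongrLeft]

theorem negRev_mem {r : EuclideanSpace ℝ (Fin n)} (hr : r ∈ antitoneCone n) :
    negRev n r ∈ antitoneCone n := by
  intro i j hij
  rw [negRev_apply, negRev_apply, neg_le_neg_iff]
  exact hr _ _ (Fin.rev_le_rev.2 hij)

theorem negRev_negRev (r : EuclideanSpace ℝ (Fin n)) : negRev n (negRev n r) = r := by
  ext i
  rw [negRev_apply, negRev_apply, neg_neg, Fin.rev_rev]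

theorem dev_negRev {R : EuclideanSpace ℝ (Fin n)} (hR : R ∈ antitoneCone n) (u : ℝ)
    (z : EuclideanSpace ℝ (Fin n)) :
    dev (antitoneCone n) (negRev n R) u (negRev n z) = negRev n (dev (antitoneCone n) R u z) := by
  have h := (isModel_antitoneCone hR).isProj_proj (R + u • z)
  have h' : IsProj (antitoneCone n) (negRev n R + u • negRev n z)
      (negRev n (proj (antitoneCone n) (R + u • z))) := by
    refine ⟨negRev_mem h.1, fun w hw => ?_⟩
    have := h.2 _ (negRev_mem hw)
    rwa [← (negRev n).inner_map_map, map_sub, map_sub, negRev_negRev, map_add, map_smul] at this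
  rw [dev, ((isModel_antitoneCone (negRev_mem hR)).isProj_proj _).unique h', dev, map_sub]

/-- Underestimation of `R` is overestimation of the reversed and negated scores, and the noise law
is invariant under that isometry. -/
theorem risk_one_eq {R : EuclideanSpace ℝ (Fin n)} (hR : R ∈ antitoneCone n) :
    risk (antitoneCone n) R 1 = posRisk R + posRisk (negRev n R) := by
  have hinteg : ∀ {R : EuclideanSpace ℝ (Fin n)}, R ∈ antitoneCone n → ∀ i : Fin n,
      Integrable (fun z => max (dev (antitoneCone n) R 1 z i) 0 ^ 2)
        (stdGaussian (EuclideanSpace ℝ (Fin n))) := by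
    intro R hR i
    have hm := isModel_antitoneCone hR
    have hc := hm.continuous_dev zero_le_one
    refine (hm.integrable_dev_sq zero_le_one).mono' (by fun_prop) (ae_of_all _ fun z => ?_)
    rw [Real.norm_of_nonneg (by positivity), EuclideanSpace.real_norm_sq_eq]
    refine le_trans ?_ (Finset.single_le_sum
      (f := fun i => dev (antitoneCone n) R 1 z i ^ 2) (fun i _ => sq_nonneg _)
      (Finset.mem_univ i))
    rcases le_total (dev (antitoneCone n) R 1 z i) 0 with h | h <;> simp [h, sq_nonneg]
  have hneg : posRisk (negRev n R) = ∑ i, ∫ z, max (-dev (antitoneCone n) R 1 z i) 0 ^ 2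
      ∂(stdGaussian (EuclideanSpace ℝ (Fin n))) := by
    rw [posRisk, ← Equiv.sum_comp Fin.revPerm]
    refine Finset.sum_congr rfl fun i _ => ?_
    rw [← (measurePreserving_isometryEquiv (negRev n)).integral_comp
      (negRev n).toHomeomorph.measurableEmbedding]
    simp_rw [dev_negRev hR, negRev_apply]
    simp
  have hintneg : ∀ i : Fin n, Integrable (fun z => max (-dev (antitoneCone n) R 1 z i) 0 ^ 2)
      (stdGaussian (EuclideanSpace ℝ (Fin n))) := fun i => by
    have := (measurePreserving_isometryEquiv (negRev n)).integrable_comp_of_integrable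
      (hinteg (negRev_mem hR) (Fin.rev i))
    simpa [Function.comp_def, dev_negRev hR, negRev_apply] using this
  rw [hneg, posRisk, ← Finset.sum_add_distrib, risk]
  simp_rw [← integral_add (hinteg hR _) (hintneg _), EuclideanSpace.real_norm_sq_eq]
  refine Eq.trans ?_ (integral_finsetSum _ fun i _ => (hinteg hR i).add (hintneg i))
  refine integral_congr_ae (ae_of_all _ fun z => Finset.sum_congr rfl fun i _ => ?_)
  rcases le_total (dev (antitoneCone n) R 1 z i) 0 with h | h
  · rw [max_eq_right h, max_eq_left (by linarith)]; ring
  · rw [max_eq_left h, max_eq_right (by linarith)]; ring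

theorem smul_mem_antitoneCone {r : EuclideanSpace ℝ (Fin n)} (hr : r ∈ antitoneCone n) {a : ℝ}
    (ha : 0 ≤ a) : a • r ∈ antitoneCone n := fun i j hij => by
  simpa using mul_le_mul_of_nonneg_left (hr i j hij) ha

theorem dev_smul {R : EuclideanSpace ℝ (Fin n)} (hR : R ∈ antitoneCone n) {a : ℝ} (ha : 0 < a)
    (u : ℝ) (z : EuclideanSpace ℝ (Fin n)) :
    dev (antitoneCone n) (a • R) (a * u) z = a • dev (antitoneCone n) R u z := by
  have h := (isModel_antitoneCone hR).isProj_proj (R + u • z)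
  have h' : IsProj (antitoneCone n) (a • R + (a * u) • z)
      (a • proj (antitoneCone n) (R + u • z)) := by
    refine ⟨smul_mem_antitoneCone h.1 ha.le, fun w hw => ?_⟩
    have h1 := h.2 _ (smul_mem_antitoneCone hw (inv_pos.2 ha).le)
    have e1 : a • R + (a * u) • z - a • proj (antitoneCone n) (R + u • z) =
        a • (R + u • z - proj (antitoneCone n) (R + u • z)) := by module
    have e2 : w - a • proj (antitoneCone n) (R + u • z) =
        a • (a⁻¹ • w - proj (antitoneCone n) (R + u • z)) := by
      rw [smul_sub, smul_inv_smul₀ ha.ne']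
    rw [e1, e2, real_inner_smul_left, real_inner_smul_right]
    exact mul_nonpos_of_nonneg_of_nonpos ha.le (mul_nonpos_of_nonneg_of_nonpos ha.le h1)
  rw [dev, ((isModel_antitoneCone (smul_mem_antitoneCone hR ha.le)).isProj_proj _).unique h',
    dev, smul_sub]

/-- Nonasymptotic risk bound for isotonic regression, with a free window length `N`. -/
theorem risk_le {R : EuclideanSpace ℝ (Fin n)} (hR : R ∈ antitoneCone n) {V u : ℝ}
    (hV : ∀ i j, R i - R j ≤ V) (hV0 : 0 ≤ V) (hu : 0 < u) {N : ℕ} (hN : 1 ≤ N) :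
    risk (antitoneCone n) R u ≤
      2 * u ^ 2 * (n / N + (1 + Real.log N) + 2 * √N * (V / u)) := by
  have hS : u⁻¹ • R ∈ antitoneCone n := smul_mem_antitoneCone hR (inv_pos.2 hu).le
  have hscale : risk (antitoneCone n) R u = u ^ 2 * risk (antitoneCone n) (u⁻¹ • R) 1 := by
    rw [risk, risk, ← integral_const_mul]
    refine integral_congr_ae (ae_of_all _ fun z => ?_)
    have := dev_smul hS hu 1 z
    rw [smul_inv_smul₀ hu.ne', mul_one] at this
    simp only [this, norm_smul, mul_pow, Real.norm_eq_abs, sq_abs]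
  have hSV : ∀ i j, (u⁻¹ • R) i - (u⁻¹ • R) j ≤ V / u := fun i j => by
    have := mul_le_mul_of_nonneg_left (hV i j) (inv_pos.2 hu).le
    simp only [PiLp.smul_apply, smul_eq_mul]
    rw [div_eq_inv_mul]; linarith
  have hVu : 0 ≤ V / u := by positivity
  have h1 := posRisk_le hS hSV hVu hN
  have h2 := posRisk_le (negRev_mem hS) (V := V / u) (fun i j => by
    rw [negRev_apply, negRev_apply]
    linarith [hSV (Fin.rev j) (Fin.rev i)]) hVu hN
  rw [hscale, risk_one_eq hS]
  nlinarith [sq_nonneg u]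

end UpperBound

/-! ### Bounded models and the operations that transport configurations -/

section Box

variable {n : ℕ}

/-- The nonincreasing vectors with values in `[0, V]`. -/
def boxCone (n : ℕ) (V : ℝ) : Set (EuclideanSpace ℝ (Fin n)) :=
  {r | r ∈ antitoneCone n ∧ ∀ i, 0 ≤ r i ∧ r i ≤ V}

theorem isModel_boxCone {V : ℝ} {R : EuclideanSpace ℝ (Fin n)} (hR : R ∈ boxCone n V) :
    IsModel (boxCone n V) R := by
  have e : boxCone n V = antitoneCone n ∩ ⋂ i, {r | 0 ≤ r i ∧ r i ≤ V} := by
    ext r; simp [boxCone]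
  have hm := isModel_antitoneCone hR.1
  refine ⟨?_, ?_, hR⟩
  · rw [e]
    refine hm.closed.inter (isClosed_iInter fun i => ?_)
    have h1 : IsClosed {r : EuclideanSpace ℝ (Fin n) | 0 ≤ r i} :=
      isClosed_le (by fun_prop) (by fun_prop)
    have h2 : IsClosed {r : EuclideanSpace ℝ (Fin n) | r i ≤ V} :=
      isClosed_le (by fun_prop) (by fun_prop)
    exact h1.inter h2
  · intro x hx y hy a b ha hb hab
    refine ⟨hm.convex hx.1 hy.1 ha hb hab, fun i => ?_⟩
    simp only [PiLp.add_apply, PiLp.smul_apply, smul_eq_mul]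
    have hx' := hx.2 i
    have hy' := hy.2 i
    refine ⟨add_nonneg (mul_nonneg ha hx'.1) (mul_nonneg hb hy'.1), ?_⟩
    have h1 := mul_le_mul_of_nonneg_left hx'.2 ha
    have h2 := mul_le_mul_of_nonneg_left hy'.2 hb
    have h3 : a * V + b * V = V := by rw [← add_mul, hab, one_mul]
    linarith

theorem boxCone_subset (n : ℕ) (V : ℝ) : boxCone n V ⊆ antitoneCone n := fun _ h => h.1

/-- At the apex of a cone, twice the projection is again a competitor. -/
theorem gain_zero_le {u : ℝ} (hu : 0 < u) (z : EuclideanSpace ℝ (Fin n)) :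
    gain (antitoneCone n) 0 u z ≤ ‖dev (antitoneCone n) 0 u z‖ ^ 2 / (2 * u) := by
  have h0 : (0 : EuclideanSpace ℝ (Fin n)) ∈ antitoneCone n := fun i j _ => le_rfl
  have hm := isModel_antitoneCone h0
  have hd := hm.add_dev_mem u z
  rw [zero_add] at hd
  have h1 := hm.inner_dev_le hu z (smul_mem_antitoneCone hd (zero_le_two))
  rw [sub_zero, real_inner_smul_right, real_inner_smul_right, real_inner_self_eq_norm_sq] at h1
  rw [gain]
  have e : ‖dev (antitoneCone n) 0 u z‖ ^ 2 / u =
      2 * (‖dev (antitoneCone n) 0 u z‖ ^ 2 / (2 * u)) := by field_simp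
  rw [mul_div_assoc, e] at h1
  linarith

/-- For constant scores there is no bias, so `risk_le` applies with `V = 0` and a window as long as
the sample, leaving only the logarithm. -/
theorem meanGain_zero_le (hn : 1 ≤ n) {u : ℝ} (hu : 0 < u) :
    meanGain (antitoneCone n) 0 u ≤ u * (2 + Real.log n) := by
  have h0 : (0 : EuclideanSpace ℝ (Fin n)) ∈ antitoneCone n := fun i j _ => le_rfl
  have hm := isModel_antitoneCone h0
  have h1 : meanGain (antitoneCone n) 0 u ≤ risk (antitoneCone n) 0 u / (2 * u) := by
    rw [meanGain, risk, ← integral_div]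
    exact integral_mono (hm.integrable_gain hu) ((hm.integrable_dev_sq hu.le).div_const _)
      fun z => gain_zero_le hu z
  have h2 := risk_le h0 (V := 0) (u := u) (by simp) le_rfl hu hn
  have hn0 : (n : ℝ) ≠ 0 := by exact_mod_cast (by omega : n ≠ 0)
  rw [div_self hn0, zero_div, mul_zero, add_zero] at h2
  refine h1.trans ?_
  rw [div_le_iff₀ (by positivity)]
  linarith

/-- Restricting the fit to the range of the true scores loses little. -/
theorem meanGain_antitoneCone_le (hn : 1 ≤ n) {V u : ℝ} {R : EuclideanSpace ℝ (Fin n)}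
    (hR : R ∈ boxCone n V) (hu : 0 < u) :
    meanGain (antitoneCone n) R u ≤ meanGain (boxCone n V) R u + 2 * (u * (2 + Real.log n)) := by
  have h0 : (0 : EuclideanSpace ℝ (Fin n)) ∈ antitoneCone n := fun i j _ => le_rfl
  have hm := isModel_antitoneCone hR.1
  have hm0 := isModel_antitoneCone h0
  have hmb := isModel_boxCone hR
  have hpath : ∀ z, gain (antitoneCone n) R u z ≤ gain (boxCone n V) R u z +
      (gain (antitoneCone n) 0 u z + gain (antitoneCone n) 0 u z) := by
    intro z
    obtain ⟨θ, hθ, e⟩ := hm.exists_gain_eq u z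
    let a : EuclideanSpace ℝ (Fin n) := WithLp.toLp 2 fun i => max 0 (min V (θ i))
    let b : EuclideanSpace ℝ (Fin n) := WithLp.toLp 2 fun i => max (θ i - V) 0
    let c : EuclideanSpace ℝ (Fin n) := WithLp.toLp 2 fun i => min (θ i) 0
    have hV : ∀ i, 0 ≤ V := fun i => (hR.2 i).1.trans (hR.2 i).2
    have ha : a ∈ boxCone n V := by
      refine ⟨fun i j hij => ?_, fun i => ⟨le_max_left _ _, max_le (hV i) (min_le_left _ _)⟩⟩
      exact max_le_max le_rfl (min_le_min le_rfl (hθ i j hij))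
    have hb : b ∈ antitoneCone n := fun i j hij =>
      max_le_max (sub_le_sub_right (hθ i j hij) V) le_rfl
    have hc : c ∈ antitoneCone n := fun i j hij => min_le_min (hθ i j hij) le_rfl
    have h1 := hmb.le_gain hu z ha
    have h2 := hm0.le_gain hu z hb
    have h3 := hm0.le_gain hu z hc
    rw [sub_zero] at h2 h3
    have hsum : θ - R = (a - R) + b + c := by
      ext i
      simp only [PiLp.sub_apply, PiLp.add_apply, a, b, c]
      have := hV i
      rcases le_total (θ i) 0 with h | h
      · rw [min_eq_right (h.trans this), max_eq_left h, max_eq_right (by linarith),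
          min_eq_left h]; ring
      · rcases le_total (θ i) V with h' | h'
        · rw [min_eq_right h', max_eq_right h, max_eq_right (by linarith), min_eq_right h]; ring
        · rw [min_eq_left h', max_eq_right this, max_eq_left (by linarith), min_eq_right h]; ring
    -- The cross terms are nonnegative: where `b` is positive the clipped value is `V ≥ R i`, and
    -- where `c` is negative it is `0 ≤ R i`. So the gain splits, and the two excesses are
    -- competitors for the zero vector.
    have hnorm : ‖a - R‖ ^ 2 + ‖b‖ ^ 2 + ‖c‖ ^ 2 ≤ ‖θ - R‖ ^ 2 := by
      simp only [EuclideanSpace.real_norm_sq_eq, ← Finset.sum_add_distrib]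
      refine Finset.sum_le_sum fun i _ => ?_
      simp only [PiLp.sub_apply, a, b, c]
      have hV' := hV i
      have hRi := hR.2 i
      rcases le_total (θ i) 0 with h | h
      · rw [min_eq_right (h.trans hV'), max_eq_left h, max_eq_right (by linarith),
          min_eq_left h]
        nlinarith
      · rcases le_total (θ i) V with h' | h'
        · rw [min_eq_right h', max_eq_right h, max_eq_right (by linarith), min_eq_right h]
          linarith
        · rw [min_eq_left h', max_eq_right hV', max_eq_left (by linarith), min_eq_right h]
          nlinarith
    have hdiv : ‖a - R‖ ^ 2 / (2 * u) + ‖b‖ ^ 2 / (2 * u) + ‖c‖ ^ 2 / (2 * u) ≤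
        ‖θ - R‖ ^ 2 / (2 * u) := by
      rw [← add_div, ← add_div]; gcongr
    rw [e]
    nth_rewrite 1 [hsum]
    rw [inner_add_right, inner_add_right]
    linarith
  have hig := hm0.integrable_gain hu
  have hinteg := integral_mono (hm.integrable_gain hu)
    ((hmb.integrable_gain hu).add (hig.add hig)) hpath
  rw [integral_add' (hmb.integrable_gain hu) (hig.add hig), integral_add' hig hig] at hinteg
  have := meanGain_zero_le hn hu
  unfold meanGain at *
  linarith

/-- Some true scores in `[0, V]` have mean gain at least `a` at noise level `u`. -/
def Achieves (n : ℕ) (u V a : ℝ) : Prop :=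
  ∃ R ∈ boxCone n V, a ≤ meanGain (boxCone n V) R u

variable {u v V a : ℝ}

theorem Achieves.mono_level (h : Achieves n u V a) (hu : 0 < u) (huv : u ≤ v) :
    Achieves n v V a := by
  obtain ⟨R, hR, ha⟩ := h
  exact ⟨R, hR, ha.trans ((isModel_boxCone hR).meanGain_mono_level hu huv)⟩

/-- This operation, `Achieves.group` and `Achieves.concat` all leave `a / (n u V²)^{1/3}` unchanged:
both terms are multiplied by `c`, `√m` and `k` respectively. -/
theorem Achieves.scale (h : Achieves n u V a) (hu : 0 < u) {c : ℝ} (hc : 0 < c) :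
    Achieves n (c * u) (c * V) (c * a) := by
  obtain ⟨R, hR, ha⟩ := h
  have hmem : ∀ θ ∈ boxCone n V, c • θ ∈ boxCone n (c * V) := fun θ hθ =>
    ⟨smul_mem_antitoneCone hθ.1 hc.le, fun i =>
      ⟨mul_nonneg hc.le (hθ.2 i).1, mul_le_mul_of_nonneg_left (hθ.2 i).2 hc.le⟩⟩
  refine ⟨c • R, hmem R hR, ?_⟩
  have := card_mul_meanGain_le (J := Unit) (isModel_boxCone hR) (isModel_boxCone (hmem R hR))
    (fun _ => LinearIsometry.id) (fun i j hij => absurd rfl hij) hc (fun θ hθ => by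
      have e : c • R + c • ∑ j, LinearIsometry.id (R := ℝ) (θ j - R) = c • θ () := by
        simp [smul_sub]
      rw [e]; exact hmem _ (hθ ())) hu
  simp only [Fintype.card_unit, Nat.cast_one, mul_one] at this
  exact (mul_le_mul_of_nonneg_left ha hc.le).trans this

/-- Repeating every coordinate `m` times, normalized to be an isometry. -/
def groupIsometry (n : ℕ) {m : ℕ} (hm : 1 ≤ m) :
    EuclideanSpace ℝ (Fin n) →ₗᵢ[ℝ] EuclideanSpace ℝ (Fin (n * m)) where
  toFun t := WithLp.toLp 2 fun i => (√m)⁻¹ * t i.divNat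
  map_add' s t := by ext i; simp [mul_add]
  map_smul' c t := by ext i; simp; ring
  norm_map' t := by
    have hm0 : (m : ℝ) ≠ 0 := by exact_mod_cast (by omega : m ≠ 0)
    rw [← sq_eq_sq₀ (norm_nonneg _) (norm_nonneg _), EuclideanSpace.real_norm_sq_eq,
      EuclideanSpace.real_norm_sq_eq, ← Equiv.sum_comp finProdFinEquiv, Fintype.sum_prod_type]
    refine Finset.sum_congr rfl fun p _ => ?_
    have : ∀ q : Fin m, (finProdFinEquiv (p, q)).divNat = p := fun q =>
      congrArg Prod.fst (finProdFinEquiv.symm_apply_apply (p, q))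
    simp only [LinearMap.coe_mk, AddHom.coe_mk, this, Finset.sum_const, Finset.card_univ,
      Fintype.card_fin, nsmul_eq_mul, mul_pow, inv_pow, Real.sq_sqrt (Nat.cast_nonneg m)]
    field_simp

theorem Achieves.group (h : Achieves n u V a) (hu : 0 < u) {m : ℕ} (hm : 1 ≤ m) :
    Achieves (n * m) (√m * u) V (√m * a) := by
  obtain ⟨R, hR, ha⟩ := h
  have hm0 : (0 : ℝ) < √m := Real.sqrt_pos.2 (by exact_mod_cast hm)
  let g : EuclideanSpace ℝ (Fin n) → EuclideanSpace ℝ (Fin (n * m)) := fun θ =>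
    WithLp.toLp 2 fun i => θ i.divNat
  have hg : ∀ θ ∈ boxCone n V, g θ ∈ boxCone (n * m) V := fun θ hθ =>
    ⟨fun i j hij => hθ.1 _ _ (Fin.le_def.2 (Nat.div_le_div_right hij)), fun i => hθ.2 _⟩
  refine ⟨g R, hg R hR, ?_⟩
  have := card_mul_meanGain_le (J := Unit) (isModel_boxCone hR) (isModel_boxCone (hg R hR))
    (fun _ => groupIsometry n hm) (fun i j hij => absurd rfl hij) hm0 (fun θ hθ => by
      have e : g R + √m • ∑ j, groupIsometry n hm (θ j - R) = g (θ ()) := by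
        ext i
        simp [g, groupIsometry, hm0.ne']
      rw [e]; exact hg _ (hθ ())) hu
  simp only [Fintype.card_unit, Nat.cast_one, mul_one] at this
  exact (mul_le_mul_of_nonneg_left ha hm0.le).trans this

/-- The inclusion of the `j`-th of `k` consecutive blocks of length `n`. -/
def blockIsometry (n : ℕ) {k : ℕ} (j : Fin k) :
    EuclideanSpace ℝ (Fin n) →ₗᵢ[ℝ] EuclideanSpace ℝ (Fin (k * n)) where
  toFun t := WithLp.toLp 2 fun i => if i.divNat = j then t i.modNat else 0
  map_add' s t := by ext i; by_cases h : i.divNat = j <;> simp [h]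
  map_smul' c t := by ext i; by_cases h : i.divNat = j <;> simp [h]
  norm_map' t := by
    rw [← sq_eq_sq₀ (norm_nonneg _) (norm_nonneg _), EuclideanSpace.real_norm_sq_eq,
      EuclideanSpace.real_norm_sq_eq, ← Equiv.sum_comp finProdFinEquiv, Fintype.sum_prod_type]
    have h1 : ∀ (p : Fin k) (q : Fin n), (finProdFinEquiv (p, q)).divNat = p := fun p q =>
      congrArg Prod.fst (finProdFinEquiv.symm_apply_apply (p, q))
    have h2 : ∀ (p : Fin k) (q : Fin n), (finProdFinEquiv (p, q)).modNat = q := fun p q =>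
      congrArg Prod.snd (finProdFinEquiv.symm_apply_apply (p, q))
    simp only [LinearMap.coe_mk, AddHom.coe_mk, h1, h2]
    rw [Finset.sum_eq_single j (fun p _ hp => by simp [hp]) (by simp)]
    simp

theorem Achieves.concat (h : Achieves n u V a) (hu : 0 < u) (k : ℕ) :
    Achieves (k * n) u (k * V) (k * a) := by
  obtain ⟨R, hR, ha⟩ := h
  let g : (Fin k → EuclideanSpace ℝ (Fin n)) → EuclideanSpace ℝ (Fin (k * n)) := fun θ =>
    -- The blocks occupy stacked intervals of length `V`, so arbitrary independent choices in the
    -- blocks still give a nonincreasing vector. This is why the models are bounded.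
    WithLp.toLp 2 fun i => ((k : ℝ) - 1 - (i.divNat : ℕ)) * V + θ i.divNat i.modNat
  have hg : ∀ θ : Fin k → EuclideanSpace ℝ (Fin n), (∀ j, θ j ∈ boxCone n V) →
      g θ ∈ boxCone (k * n) (k * V) := by
    intro θ hθ
    have hV : ∀ i : Fin (k * n), 0 ≤ V := fun i =>
      ((hθ i.divNat).2 i.modNat).1.trans ((hθ i.divNat).2 i.modNat).2
    refine ⟨fun i j hij => ?_, fun i => ?_⟩
    · simp only [g]
      have hd : i.divNat ≤ j.divNat := Fin.le_def.2 (Nat.div_le_div_right hij)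
      rcases hd.eq_or_lt with hd | hd
      · have hmod : i.modNat ≤ j.modNat := by
          change i.val % n ≤ j.val % n
          have h1 : i.val / n = j.val / n := by simpa using congrArg Fin.val hd
          have h2 := Nat.div_add_mod i.val n
          have h3 := Nat.div_add_mod j.val n
          have h4 : i.val ≤ j.val := hij
          rw [h1] at h2
          omega
        rw [hd]
        have := (hθ j.divNat).1 _ _ hmod
        linarith
      · have h1 : ((i.divNat : ℕ) : ℝ) + 1 ≤ ((j.divNat : ℕ) : ℝ) := by
          exact_mod_cast Fin.lt_def.1 hd
        have h2 := ((hθ i.divNat).2 i.modNat).1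
        have h3 := ((hθ j.divNat).2 j.modNat).2
        nlinarith [hV i]
    · have h1 : ((i.divNat : ℕ) : ℝ) + 1 ≤ (k : ℝ) := by exact_mod_cast i.divNat.2
      have h2 := (hθ i.divNat).2 i.modNat
      have h3 : (0 : ℝ) ≤ ((i.divNat : ℕ) : ℝ) := by positivity
      have h4 := hV i
      simp only [g]
      constructor
      · nlinarith
      · nlinarith
  have hgR := hg (fun _ => R) fun _ => hR
  refine ⟨g fun _ => R, hgR, ?_⟩
  have := card_mul_meanGain_le (J := Fin k) (isModel_boxCone hR) (isModel_boxCone hgR)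
    (fun j => blockIsometry n j) (fun i j hij s t => by
      rw [PiLp.inner_apply]
      refine Finset.sum_eq_zero fun l _ => ?_
      by_cases h : l.divNat = i
      · simp [blockIsometry, h, hij]
      · simp [blockIsometry, h]) one_pos (fun θ hθ => by
      have e : (g fun _ => R) + (1 : ℝ) • ∑ j, blockIsometry n j (θ j - R) = g θ := by
        ext i
        simp [g, blockIsometry]
      rw [e]; exact hg θ hθ) hu
  simp only [Fintype.card_fin, one_mul] at this
  exact (mul_le_mul_of_nonneg_left ha (by positivity)).trans this

/-- Extension by zero. -/
def padIsometry (n r : ℕ) : EuclideanSpace ℝ (Fin n) →ₗᵢ[ℝ] EuclideanSpace ℝ (Fin (n + r)) where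
  toFun t := WithLp.toLp 2 fun i => if h : i.val < n then t ⟨i, h⟩ else 0
  map_add' s t := by ext i; by_cases h : i.val < n <;> simp [h]
  map_smul' c t := by ext i; by_cases h : i.val < n <;> simp [h]
  norm_map' t := by
    rw [← sq_eq_sq₀ (norm_nonneg _) (norm_nonneg _), EuclideanSpace.real_norm_sq_eq,
      EuclideanSpace.real_norm_sq_eq, Fin.sum_univ_add]
    simp

theorem Achieves.pad (h : Achieves n u V a) (hu : 0 < u) (hV : 0 ≤ V) {n' : ℕ} (hn : n ≤ n') :
    Achieves n' u V a := by
  obtain ⟨r, rfl⟩ := Nat.exists_eq_add_of_le hn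
  obtain ⟨R, hR, ha⟩ := h
  have hg : ∀ θ ∈ boxCone n V, padIsometry n r θ ∈ boxCone (n + r) V := by
    intro θ hθ
    refine ⟨fun i j hij => ?_, fun i => ?_⟩
    · simp only [padIsometry, LinearIsometry.coe_mk, LinearMap.coe_mk, AddHom.coe_mk]
      by_cases hj : j.val < n
      · have hi : i.val < n := lt_of_le_of_lt hij hj
        rw [dif_pos hi, dif_pos hj]
        exact hθ.1 _ _ hij
      · rw [dif_neg hj]
        split_ifs
        · exact (hθ.2 _).1
        · exact le_rfl
    · simp only [padIsometry, LinearIsometry.coe_mk, LinearMap.coe_mk, AddHom.coe_mk]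
      split_ifs
      · exact hθ.2 _
      · exact ⟨le_rfl, hV⟩
  refine ⟨padIsometry n r R, hg R hR, ?_⟩
  have := card_mul_meanGain_le (J := Unit) (isModel_boxCone hR) (isModel_boxCone (hg R hR))
    (fun _ => padIsometry n r) (fun i j hij => absurd rfl hij) one_pos (fun θ hθ => by
      have e : padIsometry n r R + (1 : ℝ) • ∑ j, padIsometry n r (θ j - R) =
          padIsometry n r (θ ()) := by
        simp [map_sub]
      rw [e]; exact hg _ (hθ ())) hu
  simp only [Fintype.card_unit, Nat.cast_one, mul_one, one_mul] at this
  exact ha.trans this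

end Box

/-! ### Asymptotic optimality of transported copies and finiteness of the ratio -/

section Asymptotics

variable {n : ℕ} {u V a : ℝ}

theorem Achieves.le_value {b : ℝ} (h : Achieves n u V a) (hb : b ≤ a) : Achieves n u V b := by
  obtain ⟨R, hR, ha⟩ := h
  exact ⟨R, hR, hb.trans ha⟩

/-- Rescaled, repeated and concatenated copies of a configuration of size `n₀` inside one of
size `n`. -/
theorem Achieves.transfer {n₀ k m : ℕ} {u₀ V₀ : ℝ} (h : Achieves n₀ u₀ V₀ a) (hu₀ : 0 < u₀)
    (hV₀ : 0 < V₀) (hu : 0 < u) (hV : 0 < V) (hk : 1 ≤ k) (hm : 1 ≤ m)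
    (hlevel : √m * u₀ * V ≤ k * (u * V₀)) (hn : k * n₀ * m ≤ n) :
    Achieves n u V (V / V₀ * √m * a) := by
  have hk0 : (0 : ℝ) < k := by exact_mod_cast hk
  have hm0 : (0 : ℝ) < √m := Real.sqrt_pos.2 (by exact_mod_cast hm)
  have h1 := ((h.concat hu₀ k).group hu₀ hm).scale (c := V / (k * V₀)) (by positivity)
    (by positivity)
  have e1 : V / (k * V₀) * (k * V₀) = V := by field_simp
  have e2 : V / (k * V₀) * (√m * (k * a)) = V / V₀ * √m * a := by field_simp
  rw [e1, e2] at h1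
  refine (h1.mono_level (by positivity) ?_).pad hu hV.le hn
  rw [div_mul_eq_mul_div, div_le_iff₀ (by positivity)]
  linarith

/-- Without integrality one would take `√m = y` and `k = √m u₀ V / (u V₀)`, filling exactly `n`
coordinates and keeping the ratio of the original configuration. The strict inequality on `κ` leaves
room for rounding. -/
theorem Achieves.eventually {n₀ : ℕ} {u₀ V₀ κ : ℝ} (h : Achieves n₀ u₀ V₀ a) (hn₀ : 1 ≤ n₀)
    (hu₀ : 0 < u₀) (hV₀ : 0 < V₀) (hu : 0 < u) (hV : 0 < V) (hκ0 : 0 ≤ κ)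
    (hκ : κ * (n₀ * u₀ * V₀ ^ 2) ^ (1 / 3 : ℝ) < a) :
    ∀ᶠ n : ℕ in atTop, Achieves n u V (κ * (n * u * V ^ 2) ^ (1 / 3 : ℝ)) := by
  have hn₀' : (0 : ℝ) < n₀ := by exact_mod_cast hn₀
  set G := (n₀ * u₀ * V₀ ^ 2) ^ (1 / 3 : ℝ) with hG
  have hG0 : 0 < G := by positivity
  have ha : 0 < a := lt_of_le_of_lt (by positivity) hκ
  -- Shrinking `y` by a factor `τ < 1` absorbs the ceiling in `k`; `τ a > κ G` absorbs the floor in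
  -- `m`.
  obtain ⟨τ, hτ1, hτ2⟩ := exists_between ((div_lt_one ha).2 hκ)
  have hτ0 : 0 < τ := lt_of_le_of_lt (by positivity) hτ1
  rw [div_lt_iff₀ ha] at hτ1
  set B := u * V₀ / (n₀ * u₀ * V) with hB
  have hB0 : 0 < B := by positivity
  have hy : Tendsto (fun n : ℕ => ((n : ℝ) * B) ^ (1 / 3 : ℝ)) atTop atTop :=
    (tendsto_rpow_atTop (by norm_num)).comp
      (tendsto_natCast_atTop_atTop.atTop_mul_const hB0)
  have hτ3 : 0 < 1 - τ ^ 3 := by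
    have : τ ^ 3 < 1 := pow_lt_one₀ hτ0.le hτ2 (by norm_num)
    linarith
  filter_upwards [hy.eventually_ge_atTop (2 / τ), hy.eventually_ge_atTop (a / (τ * a - κ * G)),
    hy.eventually_ge_atTop (n₀ * B * τ ^ 2 / (1 - τ ^ 3)), eventually_ge_atTop 1]
    with n h1 h2 h3 hn1
  have hn0 : (0 : ℝ) < n := by exact_mod_cast hn1
  set y := ((n : ℝ) * B) ^ (1 / 3 : ℝ) with hyd
  have hy0 : 0 < y := by positivity
  have hy3 : y ^ 3 = n * B := by
    rw [hyd, ← Real.rpow_natCast, ← Real.rpow_mul (by positivity)]; norm_num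
  rw [div_le_iff₀ hτ0] at h1
  rw [div_le_iff₀ (by linarith)] at h2
  rw [div_le_iff₀ hτ3] at h3
  have hroot : (n * u * V ^ 2) ^ (1 / 3 : ℝ) = y * (V / V₀) * G := by
    have e : (n * u * V ^ 2 : ℝ) = (y * (V / V₀) * G) ^ 3 := by
      have hG3 : G ^ 3 = n₀ * u₀ * V₀ ^ 2 := by
        rw [hG, ← Real.rpow_natCast, ← Real.rpow_mul (by positivity)]; norm_num
      rw [mul_pow, mul_pow, hy3, hG3, hB]
      field_simp
    rw [e, ← Real.rpow_natCast, ← Real.rpow_mul (by positivity)]; norm_num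
  set m := ⌊(τ * y) ^ 2⌋₊ with hm
  set k := ⌈√m * u₀ * V / (u * V₀)⌉₊ with hk
  have hmle : (m : ℝ) ≤ (τ * y) ^ 2 := Nat.floor_le (by positivity)
  have hmlt : (τ * y) ^ 2 < m + 1 := Nat.lt_floor_add_one _
  have hm1 : 1 ≤ m := by
    have : (0 : ℝ) < m := by nlinarith
    exact_mod_cast this
  have hm0 : (0 : ℝ) < m := by exact_mod_cast hm1
  have hsm : √(m : ℝ) ≤ τ * y := Real.sqrt_le_iff.2 ⟨by positivity, hmle⟩
  have hsm' : τ * y - 1 ≤ √(m : ℝ) := Real.le_sqrt_of_sq_le (by nlinarith)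
  have hsm0 : 0 < √(m : ℝ) := Real.sqrt_pos.2 hm0
  have hk1 : 1 ≤ k := Nat.one_le_iff_ne_zero.2 (Nat.ceil_pos.2 (by positivity)).ne'
  have hkle : √m * u₀ * V / (u * V₀) ≤ k := Nat.le_ceil _
  have hklt : (k : ℝ) < √m * u₀ * V / (u * V₀) + 1 := Nat.ceil_lt_add_one (by positivity)
  have hsize : k * n₀ * m ≤ n := by
    have : (k * n₀ * m : ℝ) ≤ n := by
      calc (k * n₀ * m : ℝ) ≤ (√m * u₀ * V / (u * V₀) + 1) * n₀ * m := by gcongr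
        _ = √m * m / B + n₀ * m := by rw [hB]; field_simp
        _ ≤ (τ * y) * (τ * y) ^ 2 / B + n₀ * (τ * y) ^ 2 := by gcongr
        _ = (τ ^ 3 * y ^ 3 + n₀ * B * τ ^ 2 * y ^ 2) / B := by field_simp
        _ ≤ y ^ 3 / B := by
            gcongr
            nlinarith [mul_le_mul_of_nonneg_right h3 (sq_nonneg y)]
        _ = n := by rw [hy3]; field_simp
    exact_mod_cast this
  refine (h.transfer hu₀ hV₀ hu hV hk1 hm1 ?_ hsize).le_value ?_
  · rwa [div_le_iff₀ (by positivity)] at hkle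
  · rw [hroot]
    have h4 : κ * G * y ≤ √m * a := by nlinarith [mul_le_mul_of_nonneg_right hsm' ha.le]
    calc κ * (y * (V / V₀) * G) = V / V₀ * (κ * G * y) := by ring
      _ ≤ V / V₀ * (√m * a) := by gcongr
      _ = _ := by ring

/-- The mean gain is at most of order `(n u V²)^{1/3}` when the sample is long. -/
theorem meanGain_le_of_level (hn : 1 ≤ n) {R : EuclideanSpace ℝ (Fin n)}
    (hR : R ∈ antitoneCone n) (hV : 0 < V) (hRV : ∀ i j, R i - R j ≤ V) (j : ℕ) :
    ∀ u x : ℝ, 0 < u → 0 < x → n * u = V * x ^ 3 → x ≤ 2 ^ j →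
      (∀ N : ℕ, 1 ≤ N → (N : ℝ) ≤ x ^ 2 + 1 → N * (1 + Real.log N) ≤ n) →
      meanGain (antitoneCone n) R u ≤ 46 * (V * x) := by
  have hm := isModel_antitoneCone hR
  have hsmall : ∀ u x : ℝ, 0 < u → 0 < x → n * u = V * x ^ 3 → x ≤ 1 →
      meanGain (antitoneCone n) R u ≤ 46 * (V * x) := by
    intro u x hu hx hux hx1
    have h1 := hm.meanGain_le hu
    rw [finrank_euclideanSpace_fin] at h1
    have h2 : V * x ^ 3 ≤ V * x := by
      gcongr
      nlinarith [pow_le_one₀ hx.le hx1 (n := 2)]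
    have : 0 < V * x := by positivity
    nlinarith
  induction j with
  | zero =>
    intro u x hu hx hux hxj _
    exact hsmall u x hu hx hux (by simpa using hxj)
  | succ j ih =>
    intro u x hu hx hux hxj hN
    rcases le_or_gt x 1 with hx1 | hx1
    · exact hsmall u x hu hx hux hx1
    -- Since `n u = V x³`, halving `x` divides the level by 8. The tangent inequality at `u / 8`
    -- then bounds the increase of the gain by the risk there.
    have hrec := ih (u / 8) (x / 2) (by positivity) (by positivity)
      (by rw [div_pow]; linarith) (by rw [pow_succ] at hxj; linarith)
      (fun N h1 h2 => hN N h1 (by nlinarith))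
    set t := x / 2 with ht
    have hxt : x = 2 * t := by rw [ht]; ring
    have ht0 : 0 < t := by positivity
    have ht1 : 1 / 2 < t := by linarith
    set N := ⌈t ^ 2⌉₊ with hNd
    have hN1 : 1 ≤ N := Nat.one_le_iff_ne_zero.2 (Nat.ceil_pos.2 (by positivity)).ne'
    have hN0 : (0 : ℝ) < N := by exact_mod_cast hN1
    have hNle : t ^ 2 ≤ N := Nat.le_ceil _
    have hNlt : (N : ℝ) < t ^ 2 + 1 := Nat.ceil_lt_add_one (by positivity)
    have hlog : 1 + Real.log N ≤ n / t ^ 2 := by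
      have := hN N hN1 (by rw [hxt]; nlinarith)
      rw [le_div_iff₀ (by positivity)]
      have h0 : 0 ≤ 1 + Real.log N := by
        have := Real.log_nonneg (show (1 : ℝ) ≤ N by exact_mod_cast hN1)
        linarith
      nlinarith
    have hnN : (n : ℝ) / N ≤ n / t ^ 2 := by gcongr
    have hsq : √(N : ℝ) ≤ 9 / 4 * t := Real.sqrt_le_iff.2 ⟨by positivity, by nlinarith⟩
    have hrisk := risk_le hR hRV hV.le (u := u / 8) (by positivity) hN1
    have htan := hm.meanGain_le_add_risk (u := u / 8) (v := u) (by positivity) hu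
    have e1 : (u - u / 8) / (2 * (u / 8) ^ 2) = 28 / u := by field_simp; norm_num
    rw [e1] at htan
    have hb : (n : ℝ) / N + (1 + Real.log N) + 2 * √N * (V / (u / 8)) ≤
        n / t ^ 2 + n / t ^ 2 + 2 * (9 / 4 * t) * (V / (u / 8)) := by gcongr
    have hr2 : 28 / u * risk (antitoneCone n) R (u / 8) ≤ 28 / u * (2 * (u / 8) ^ 2 *
        (n / t ^ 2 + n / t ^ 2 + 2 * (9 / 4 * t) * (V / (u / 8)))) := by
      gcongr
      exact hrisk.trans (by gcongr)
    have e2 : 28 / u * (2 * (u / 8) ^ 2 *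
        (n / t ^ 2 + n / t ^ 2 + 2 * (9 / 4 * t) * (V / (u / 8)))) =
        7 / 8 * (2 * (n * u) / t ^ 2 + 36 * (t * V)) := by field_simp; ring
    have e3 : 2 * (n * u) / t ^ 2 = 16 * (V * t) := by
      rw [hux, hxt]; field_simp; ring
    rw [e2, e3] at hr2
    have : 0 < V * t := by positivity
    -- The increment is at most `7/8 * (16 + 36) = 45.5` times `V t`, and `46 + 45.5 ≤ 2 * 46`;
    -- hence the constant 46.
    rw [hxt]
    linarith

/-- Concatenating `k` copies multiplies gain and bound by `k` and leaves `x` fixed, since `n / V` is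
unchanged. A large `k` meets the length condition that makes logarithms harmless, and dividing by
`k` gives the bound for every `n`. -/
theorem Achieves.le_bound (h : Achieves n u V a) (hn : 1 ≤ n) (hu : 0 < u) (hV : 0 < V) :
    a ≤ 46 * (n * u * V ^ 2) ^ (1 / 3 : ℝ) := by
  have hn0 : (0 : ℝ) < n := by exact_mod_cast hn
  set x := (n * u / V) ^ (1 / 3 : ℝ) with hx
  have hx0 : 0 < x := by positivity
  have hx3 : x ^ 3 = n * u / V := by
    rw [hx, ← Real.rpow_natCast, ← Real.rpow_mul (by positivity)]; norm_num
  have hroot : (n * u * V ^ 2) ^ (1 / 3 : ℝ) = V * x := by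
    have e : (n * u * V ^ 2 : ℝ) = (V * x) ^ 3 := by
      rw [mul_pow, hx3]; field_simp
    rw [e, ← Real.rpow_natCast, ← Real.rpow_mul (by positivity)]; norm_num
  rw [hroot]
  set T := (x ^ 2 + 1) * (1 + Real.log (x ^ 2 + 1)) with hT
  obtain ⟨k, hkT⟩ := exists_nat_ge (max T 1)
  have hk1 : (1 : ℝ) ≤ k := (le_max_right _ _).trans hkT
  have hkT : T ≤ k := (le_max_left _ _).trans hkT
  have hk : 1 ≤ k := by exact_mod_cast hk1
  obtain ⟨j, hj⟩ := pow_unbounded_of_one_lt x (one_lt_two)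
  obtain ⟨R, hR, ha⟩ := h.concat hu k
  have hkn : 1 ≤ k * n := Nat.mul_pos hk hn
  have hbound := meanGain_le_of_level hkn hR.1 (V := k * V) (by positivity)
    (fun i j => by linarith [(hR.2 i).2, (hR.2 j).1]) j u x hu hx0
    (by rw [hx3]; push_cast; field_simp) hj.le (fun N hN1 hN2 => by
      have hN0 : (1 : ℝ) ≤ N := by exact_mod_cast hN1
      calc (N : ℝ) * (1 + Real.log N) ≤ T := by
            have := Real.log_nonneg hN0
            rw [hT]
            gcongr
        _ ≤ k := hkT
        _ ≤ (k * n : ℕ) := by exact_mod_cast Nat.le_mul_of_pos_right k hn)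
  have hle := (isModel_boxCone hR).meanGain_mono_set (isModel_antitoneCone hR.1)
    (boxCone_subset _ _) hu
  have : k * a ≤ k * (46 * (V * x)) := by linarith
  exact le_of_mul_le_mul_left this (by linarith)

end Asymptotics

/-! ### Maximum of a Gaussian random walk and an explicit configuration -/

section Spitzer

theorem integral_max_gaussianReal : ∫ x, max x 0 ∂(gaussianReal 0 1) = 1 / √(2 * Real.pi) := by
  rw [integral_gaussianReal_eq_integral_smul one_ne_zero]
  have e : ∀ x : ℝ, gaussianPDFReal 0 1 x • max x 0 =
      (Set.Ioi (0 : ℝ)).indicator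
        (fun x => (√(2 * Real.pi))⁻¹ * (x ^ (1 : ℝ) * Real.exp (-(1 / 2) * x ^ (2 : ℝ)))) x := by
    intro x
    by_cases hx : 0 < x
    · rw [Set.indicator_of_mem (show x ∈ Set.Ioi 0 from hx), max_eq_left hx.le, gaussianPDFReal]
      simp only [NNReal.coe_one, mul_one, sub_zero, smul_eq_mul, Real.rpow_one, Real.rpow_ofNat]
      have : -x ^ 2 / 2 = -(1 / 2) * x ^ 2 := by ring
      rw [this]; ring
    · rw [Set.indicator_of_notMem (show x ∉ Set.Ioi 0 from hx), max_eq_right (not_lt.1 hx),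
        smul_zero]
  simp_rw [e]
  rw [integral_indicator measurableSet_Ioi, integral_const_mul,
    integral_rpow_mul_exp_neg_mul_rpow (by norm_num) (by norm_num) (by norm_num)]
  norm_num

variable {H : Type*} [NormedAddCommGroup H] [InnerProductSpace ℝ H] [FiniteDimensional ℝ H]
  [MeasurableSpace H] [BorelSpace H]

theorem integral_max_inner (a : H) :
    ∫ z, max ⟪a, z⟫ 0 ∂(stdGaussian H) = ‖a‖ / √(2 * Real.pi) := by
  by_cases ha : a = 0
  · simp [ha]
  have hn : 0 < ‖a‖ := norm_pos_iff.2 ha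
  have h1 : ∀ z, max ⟪a, z⟫ 0 = ‖a‖ * max ⟪‖a‖⁻¹ • a, z⟫ 0 := fun z => by
    rw [real_inner_smul_left, mul_max_of_nonneg _ _ hn.le, mul_zero, mul_inv_cancel_left₀ hn.ne']
  simp_rw [h1]
  rw [integral_const_mul]
  have hmap := map_inner_stdGaussian (‖a‖⁻¹ • a)
  have hn1 : ‖‖a‖⁻¹ • a‖₊ = 1 := by
    ext; simp [norm_smul, hn.ne']
  rw [hn1, one_pow] at hmap
  have h2 : ∫ z, max ⟪‖a‖⁻¹ • a, z⟫ 0 ∂(stdGaussian H) = ∫ x, max x 0 ∂(gaussianReal 0 1) := by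
    rw [← hmap, integral_map (by fun_prop) (by fun_prop)]
  rw [h2, integral_max_gaussianReal, mul_one_div]

variable {N : ℕ}

/-- The indicator vector of the first `j` coordinates. -/
def initVec (N j : ℕ) : EuclideanSpace ℝ (Fin N) :=
  WithLp.toLp 2 fun i => if i.val < j then 1 else 0

/-- The coordinates of `z`, extended by zero. -/
def coordOr (z : EuclideanSpace ℝ (Fin N)) (i : ℕ) : ℝ := if h : i < N then z ⟨i, h⟩ else 0

theorem continuous_coordOr (i : ℕ) : Continuous fun z : EuclideanSpace ℝ (Fin N) => coordOr z i := by
  unfold coordOr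
  split_ifs <;> fun_prop

/-- The partial sums of the coordinates of `z`. -/
def partialSum (z : EuclideanSpace ℝ (Fin N)) (j : ℕ) : ℝ := ∑ i ∈ Finset.range j, coordOr z i

theorem partialSum_eq_inner (z : EuclideanSpace ℝ (Fin N)) {j : ℕ} (hj : j ≤ N) :
    partialSum z j = ⟪initVec N j, z⟫ := by
  obtain ⟨r, rfl⟩ := Nat.exists_eq_add_of_le hj
  rw [PiLp.inner_apply, Fin.sum_univ_add, partialSum, Finset.sum_range]
  simp only [initVec, Fin.val_castAdd, Fin.is_lt, if_true, Fin.val_natAdd]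
  rw [Finset.sum_eq_zero (f := fun i : Fin r => _) (by simp), add_zero]
  refine Finset.sum_congr rfl fun i _ => ?_
  have : i.val < j + r := by omega
  simp [coordOr, this]
  rfl

theorem norm_initVec_sq {j : ℕ} (hj : j ≤ N) : ‖initVec N j‖ ^ 2 = j := by
  rw [← real_inner_self_eq_norm_sq, ← partialSum_eq_inner _ hj, partialSum]
  rw [Finset.sum_congr rfl (g := fun _ => (1 : ℝ)) fun i hi => ?_]
  · simp
  · have := Finset.mem_range.1 hi
    have h : i < N := by omega
    simp [coordOr, initVec, h, this]

theorem continuous_partialSum (j : ℕ) :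
    Continuous fun z : EuclideanSpace ℝ (Fin N) => partialSum z j :=
  continuous_finsetSum _ fun i _ => continuous_coordOr i

/-- The maximum of the partial sums up to time `j`. -/
def partialMax (z : EuclideanSpace ℝ (Fin N)) (j : ℕ) : ℝ :=
  (Finset.range (j + 1)).sup' ⟨0, by simp⟩ (partialSum z)

theorem le_partialMax (z : EuclideanSpace ℝ (Fin N)) {l j : ℕ} (h : l ≤ j) :
    partialSum z l ≤ partialMax z j :=
  Finset.le_sup' (partialSum z) (Finset.mem_range.2 (by omega))

theorem partialMax_nonneg (z : EuclideanSpace ℝ (Fin N)) (j : ℕ) : 0 ≤ partialMax z j := by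
  simpa [partialSum] using le_partialMax z (Nat.zero_le j)

theorem continuous_partialMax (j : ℕ) :
    Continuous fun z : EuclideanSpace ℝ (Fin N) => partialMax z j :=
  Continuous.finset_sup'_apply _ fun l _ => continuous_partialSum l

theorem integrable_coordOr (i : ℕ) : Integrable (fun z : EuclideanSpace ℝ (Fin N) => coordOr z i)
    (stdGaussian _) := by
  unfold coordOr
  split_ifs with h
  · have := integrable_inner_stdGaussian (EuclideanSpace.single (⟨i, h⟩ : Fin N) (1 : ℝ))
    simpa [EuclideanSpace.inner_single_left] using this
  · exact integrable_const _

theorem integrable_partialSum (j : ℕ) :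
    Integrable (fun z : EuclideanSpace ℝ (Fin N) => partialSum z j) (stdGaussian _) :=
  integrable_finsetSum _ fun i _ => integrable_coordOr i

theorem integrable_partialMax (j : ℕ) :
    Integrable (fun z : EuclideanSpace ℝ (Fin N) => partialMax z j) (stdGaussian _) := by
  refine (integrable_finsetSum (Finset.range (j + 1))
    fun l _ => (integrable_partialSum (N := N) l).abs).mono'
    (continuous_partialMax j).aestronglyMeasurable (ae_of_all _ fun z => ?_)
  rw [Real.norm_of_nonneg (partialMax_nonneg z j)]
  exact Finset.sup'_le _ _ fun l hl => (le_abs_self _).trans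
    (Finset.single_le_sum (f := fun l => |partialSum z l|) (fun _ _ => abs_nonneg _) hl)

/-- Cyclic rotation of the first `j + 1` coordinates. -/
def rotate (j : Fin N) : EuclideanSpace ℝ (Fin N) ≃ₗᵢ[ℝ] EuclideanSpace ℝ (Fin N) :=
  LinearIsometryEquiv.piLpCongrLeft 2 ℝ ℝ (Fin.cycleRange j).symm

theorem rotate_apply (j : Fin N) (z : EuclideanSpace ℝ (Fin N)) (i : Fin N) :
    rotate j z i = z (Fin.cycleRange j i) := by
  simp [rotate, LinearIsometryEquiv.piLpCongrLeft]

theorem coordOr_rotate_lt {j : Fin N} (z : EuclideanSpace ℝ (Fin N)) {i : ℕ} (hi : i < j.val) :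
    coordOr (rotate j z) i = coordOr z (i + 1) := by
  have hj := j.2
  have h1 : i < N := by omega
  have h2 : i + 1 < N := by omega
  rw [coordOr, coordOr, dif_pos h1, dif_pos h2, rotate_apply]
  have e : Fin.cycleRange j ⟨i, h1⟩ = ⟨i + 1, h2⟩ :=
    Fin.ext (Fin.coe_cycleRange_of_lt (i := ⟨i, h1⟩) hi)
  rw [e]

theorem coordOr_rotate_self {j : Fin N} (z : EuclideanSpace ℝ (Fin N)) :
    coordOr (rotate j z) j = coordOr z 0 := by
  have hj := j.2
  have : NeZero N := ⟨by omega⟩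
  have h2 : 0 < N := by omega
  rw [coordOr, coordOr, dif_pos hj, dif_pos h2, rotate_apply]
  have e : Fin.cycleRange j ⟨j.val, hj⟩ = ⟨0, h2⟩ := Fin.cycleRange_self j
  rw [e]

theorem partialSum_rotate {j : Fin N} (z : EuclideanSpace ℝ (Fin N)) {l : ℕ} (hl : l ≤ j.val) :
    coordOr z 0 + partialSum (rotate j z) l = partialSum z (l + 1) := by
  rw [partialSum, partialSum, Finset.sum_range_succ', add_comm]
  congr 1
  exact Finset.sum_congr rfl fun i hi =>
    coordOr_rotate_lt z (by have := Finset.mem_range.1 hi; omega)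

theorem partialSum_rotate_succ {j : Fin N} (z : EuclideanSpace ℝ (Fin N)) :
    partialSum (rotate j z) (j.val + 1) = partialSum z (j.val + 1) := by
  rw [← partialSum_rotate z le_rfl, partialSum, Finset.sum_range_succ, coordOr_rotate_self,
    add_comm, partialSum]

/-- One step of Spitzer's identity. -/
theorem integral_partialMax_succ (j : Fin N) :
    ∫ z, partialMax z j ∂(stdGaussian (EuclideanSpace ℝ (Fin N))) +
      knot (j.val + 1) / √(2 * Real.pi) ≤
    ∫ z, partialMax z (j.val + 1) ∂(stdGaussian (EuclideanSpace ℝ (Fin N))) := by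
  set μ := stdGaussian (EuclideanSpace ℝ (Fin N))
  let A : Set (EuclideanSpace ℝ (Fin N)) := {z | 0 < partialSum z (j.val + 1)}
  have hA : MeasurableSet A :=
    measurableSet_lt measurable_const (continuous_partialSum _).measurable
  -- The rotation permutes the first `j + 1` coordinates, so it preserves their sum and the event
  -- `A`. It follows that these coordinates have equal means on `A`.
  have hrot : ∀ f : EuclideanSpace ℝ (Fin N) → ℝ,
      ∫ z in A, f (rotate j z) ∂μ = ∫ z in A, f z ∂μ := fun f => by
    rw [← (measurePreserving_isometryEquiv (rotate j)).setIntegral_preimage_emb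
      (rotate j).toHomeomorph.measurableEmbedding f A]
    congr 2
    ext z
    simp only [A, Set.mem_preimage, Set.mem_ofPred_eq, partialSum_rotate_succ]
  have hcoord : ∀ i, i ≤ j.val → ∫ z in A, coordOr z i ∂μ = ∫ z in A, coordOr z 0 ∂μ := by
    intro i
    induction i with
    | zero => intro _; rfl
    | succ i ih =>
      intro hi
      rw [← ih (by omega), ← hrot fun z => coordOr z i]
      refine integral_congr_ae (ae_of_all _ fun z => ?_)
      exact (coordOr_rotate_lt z hi).symm
  have hj0 : (0 : ℝ) < ((j.val + 1 : ℕ) : ℝ) := by positivity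
  have hfirst : ∫ z in A, coordOr z 0 ∂μ = knot (j.val + 1) / √(2 * Real.pi) := by
    have h1 : ∫ z in A, partialSum z (j.val + 1) ∂μ =
        ((j.val + 1 : ℕ) : ℝ) * ∫ z in A, coordOr z 0 ∂μ := by
      unfold partialSum
      rw [integral_finsetSum _ fun i _ => (integrable_coordOr i).integrableOn,
        Finset.sum_congr rfl fun i hi => hcoord i (by have := Finset.mem_range.1 hi; omega)]
      simp
    have h2 : ∫ z in A, partialSum z (j.val + 1) ∂μ =
        √((j.val + 1 : ℕ) : ℝ) / √(2 * Real.pi) := by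
      have hn : ‖initVec N (j.val + 1)‖ = √((j.val + 1 : ℕ) : ℝ) := by
        rw [← norm_initVec_sq (N := N) (j := j.val + 1) j.2, Real.sqrt_sq (norm_nonneg _)]
      rw [← hn, ← integral_max_inner, ← integral_indicator hA]
      refine integral_congr_ae (ae_of_all _ fun z => ?_)
      simp only [Set.indicator_apply, A, Set.mem_ofPred_eq]
      rw [← partialSum_eq_inner z (j := j.val + 1) j.2]
      split_ifs with h
      · exact (max_eq_left h.le).symm
      · exact (max_eq_right (not_lt.1 h)).symm
    rw [h2] at h1
    have h3 : √((j.val + 1 : ℕ) : ℝ) = ((j.val + 1 : ℕ) : ℝ) * knot (j.val + 1) := by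
      rw [knot, mul_one_div, Real.div_sqrt]
    rw [h3, mul_div_assoc] at h1
    exact (mul_left_cancel₀ hj0.ne' h1).symm
  -- The walk after its first step is the rotated walk, so the first coordinate plus the rotated
  -- maximum is a lower bound for the new maximum. On `A` this gains the mean of the positive part
  -- of the sum divided by `j + 1`; off `A` monotonicity suffices.
  have hA1 : ∫ z in A, coordOr z 0 ∂μ + ∫ z in A, partialMax z j ∂μ ≤
      ∫ z in A, partialMax z (j.val + 1) ∂μ := by
    have hi : Integrable (fun z => partialMax (rotate j z) j) μ :=
      (measurePreserving_isometryEquiv (rotate j)).integrable_comp_of_integrable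
        (integrable_partialMax (N := N) j)
    rw [← hrot fun z => partialMax z j,
      ← integral_add (integrable_coordOr 0).integrableOn hi.integrableOn]
    refine setIntegral_mono ((integrable_coordOr 0).integrableOn.add hi.integrableOn)
      (integrable_partialMax _).integrableOn fun z => ?_
    change coordOr z 0 + partialMax (rotate j z) j ≤ partialMax z (j.val + 1)
    rw [← le_sub_iff_add_le']
    refine Finset.sup'_le _ _ fun l hl => ?_
    have hl' : l ≤ j.val := by have := Finset.mem_range.1 hl; omega
    rw [le_sub_iff_add_le', partialSum_rotate z hl']
    exact le_partialMax z (by omega)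
  have hA2 : ∫ z in Aᶜ, partialMax z j ∂μ ≤ ∫ z in Aᶜ, partialMax z (j.val + 1) ∂μ := by
    refine setIntegral_mono (integrable_partialMax _).integrableOn
      (integrable_partialMax _).integrableOn fun z => ?_
    exact Finset.sup'_mono _ (Finset.range_subset_range.2 (by omega)) _
  rw [← integral_add_compl hA (integrable_partialMax (N := N) j),
    ← integral_add_compl hA (integrable_partialMax (N := N) (j.val + 1)), ← hfirst]
  linarith

/-- Summing the increments `1 / √j` by comparison with `2√j`. -/
theorem le_integral_partialMax {j : ℕ} (hj : j ≤ N) :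
    2 * (√((j : ℝ) + 1) - 1) / √(2 * Real.pi) ≤
      ∫ z, partialMax z j ∂(stdGaussian (EuclideanSpace ℝ (Fin N))) := by
  induction j with
  | zero =>
    simpa using integral_nonneg fun z => partialMax_nonneg (N := N) z 0
  | succ j ih =>
    have h1 := ih (by omega)
    have h2 := integral_partialMax_succ (N := N) ⟨j, by omega⟩
    simp only at h2
    refine le_trans ?_ h2
    refine le_trans ?_ (add_le_add_left h1 _)
    rw [← add_div]
    gcongr
    push_cast
    have ha : 0 < √((j : ℝ) + 1) := Real.sqrt_pos.2 (by positivity)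
    have hb : 0 ≤ √((j : ℝ) + 1 + 1) := Real.sqrt_nonneg _
    have ha2 := Real.sq_sqrt (show (0 : ℝ) ≤ (j : ℝ) + 1 by positivity)
    have hb2 := Real.sq_sqrt (show (0 : ℝ) ≤ (j : ℝ) + 1 + 1 by positivity)
    have : 2 * (√((j : ℝ) + 1 + 1) - √((j : ℝ) + 1)) ≤ knot (j + 1) := by
      rw [knot, le_div_iff₀ (by push_cast; exact ha)]
      push_cast
      nlinarith [sq_nonneg (√((j : ℝ) + 1 + 1) - √((j : ℝ) + 1))]
    linarith

/-- Step functions against constant true scores. -/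
theorem achieves_of_partialMax {u : ℝ} (hu : 0 < u) :
    Achieves N u 1 (2 * (√((N : ℝ) + 1) - 1) / √(2 * Real.pi) - N / (8 * u)) := by
  let R : EuclideanSpace ℝ (Fin N) := WithLp.toLp 2 fun _ => 1 / 2
  have hR : R ∈ boxCone N 1 := ⟨fun i j _ => le_rfl, fun i => by
    simp only [R]; norm_num⟩
  have hm := isModel_boxCone hR
  refine ⟨R, hR, ?_⟩
  -- Every step vector lies at squared distance `N / 4` from the constant `1/2`, so the penalty is
  -- the same for all, and maximizing over steps yields the maximal partial sum.
  have hpath : ∀ z, partialMax z N - ⟪R, z⟫ - N / (8 * u) ≤ gain (boxCone N 1) R u z := by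
    intro z
    rw [sub_le_iff_le_add, sub_le_iff_le_add]
    refine Finset.sup'_le _ _ fun l hl => ?_
    have hl' : l ≤ N := by have := Finset.mem_range.1 hl; omega
    have hθ : initVec N l ∈ boxCone N 1 := by
      refine ⟨fun i j hij => ?_, fun i => ?_⟩
      · simp only [initVec]
        have := Fin.le_def.1 hij
        split_ifs <;> first | omega | norm_num
      · simp only [initVec]
        split_ifs <;> norm_num
    have h1 := hm.le_gain hu z hθ
    have h2 : ‖initVec N l - R‖ ^ 2 = N / 4 := by
      rw [EuclideanSpace.real_norm_sq_eq,
        Finset.sum_congr rfl (g := fun _ => (1 / 4 : ℝ)) fun i _ => ?_]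
      · simp; ring
      · simp only [PiLp.sub_apply, initVec, R]
        split_ifs <;> norm_num
    rw [h2, inner_sub_right, real_inner_comm, real_inner_comm R z,
      ← partialSum_eq_inner z hl'] at h1
    have e : (N : ℝ) / 4 / (2 * u) = N / (8 * u) := by rw [div_div]; ring_nf
    rw [e] at h1
    linarith
  have hi1 := integrable_partialMax (N := N) N
  have hi2 := integrable_inner_stdGaussian R
  have h := integral_mono ((hi1.sub hi2).sub (integrable_const (N / (8 * u))))
    (hm.integrable_gain hu) hpath
  rw [integral_sub' (hi1.sub hi2) (integrable_const _), integral_sub' hi1 hi2,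
    integral_inner_stdGaussian] at h
  simp only [integral_const, probReal_univ, one_smul, sub_zero] at h
  refine le_trans ?_ h
  gcongr
  exact le_integral_partialMax le_rfl

/-- The level is close to the one maximizing the normalized gain for this length, and is chosen so
that `10000 * 61.4125 = 85³` has an exact cube root. -/
theorem achieves_large : Achieves 10000 61.4125 1 58.6 := by
  refine (achieves_of_partialMax (N := 10000) (by norm_num)).le_value ?_
  have h1 : (100 : ℝ) ≤ √((10000 : ℕ) + 1) := Real.le_sqrt_of_sq_le (by norm_num)
  have h2 : √(2 * Real.pi) ≤ 2.5067 := by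
    rw [Real.sqrt_le_iff]
    have := Real.pi_lt_d4
    constructor
    · norm_num
    · norm_num at *; linarith
  have h3 : 0 < √(2 * Real.pi) := Real.sqrt_pos.2 (by positivity)
  have h4 : (198 : ℝ) / 2.5067 ≤ 2 * (√((10000 : ℕ) + 1) - 1) / √(2 * Real.pi) :=
    div_le_div₀ (by linarith) (by linarith) h3 h2
  have h5 : (58.6 : ℝ) ≤ 198 / 2.5067 - (10000 : ℕ) / (8 * 61.4125) := by norm_num
  linarith

end Spitzer

/-! ### Both risk bounds in asymptotic form -/

section Main

/-- The normalized mean gains of all configurations. -/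
def gainRatios : Set ℝ :=
  {h | ∃ (n : ℕ) (u V a : ℝ), 1 ≤ n ∧ 0 < u ∧ 0 < V ∧ Achieves n u V a ∧
    h = a / (n * u * V ^ 2) ^ (1 / 3 : ℝ)}

theorem bddAbove_gainRatios : BddAbove gainRatios := by
  refine ⟨46, ?_⟩
  rintro _ ⟨n, u, V, a, hn, hu, hV, h, rfl⟩
  have hn0 : (0 : ℝ) < n := by exact_mod_cast hn
  rw [div_le_iff₀ (by positivity)]
  exact h.le_bound hn hu hV

theorem mem_gainRatios : 58.6 / 85 ∈ gainRatios := by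
  refine ⟨10000, 61.4125, 1, 58.6, by norm_num, by norm_num, by norm_num, achieves_large, ?_⟩
  have e : (((10000 : ℕ) : ℝ) * 61.4125 * 1 ^ 2) = 85 ^ 3 := by norm_num
  rw [e, ← Real.rpow_natCast, ← Real.rpow_mul (by norm_num)]
  norm_num

theorem tendsto_log_div_rpow :
    Tendsto (fun n : ℕ => (2 + Real.log n) / (n : ℝ) ^ (1 / 3 : ℝ)) atTop (𝓝 0) := by
  have h1 : Tendsto (fun x : ℝ => Real.log x / x ^ (1 / 3 : ℝ)) atTop (𝓝 0) :=
    (isLittleO_log_rpow_atTop (by norm_num)).tendsto_div_nhds_zero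
  have h2 : Tendsto (fun x : ℝ => 2 / x ^ (1 / 3 : ℝ)) atTop (𝓝 0) :=
    tendsto_const_nhds.div_atTop (tendsto_rpow_atTop (by norm_num))
  have h3 := (h2.add h1).comp (tendsto_natCast_atTop_atTop (R := ℝ))
  rw [add_zero] at h3
  refine h3.congr fun n => ?_
  simp only [Function.comp_apply]
  rw [add_div]

/-- The same `R` has gain close to `c` times the normalization at level `v` and at most `c` times
it, up to a logarithm, at level `σ`. Maximality of `c` replaces any computation with `R`, and the
tangent inequality converts the difference into risk. -/
theorem eventually_le_risk {σ V : ℝ} (hσ : 0 < σ) (hV : 0 < V) :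
    ∀ᶠ n : ℕ in atTop, ∃ R ∈ boxCone n V,
      0.4096 * ((n : ℝ) ^ (1 / 3 : ℝ) * σ ^ (4 / 3 : ℝ) * V ^ (2 / 3 : ℝ)) ≤
        risk (antitoneCone n) R σ := by
  set c := sSup gainRatios with hc
  have hc0 : 58.6 / 85 ≤ c := le_csSup bddAbove_gainRatios mem_gainRatios
  obtain ⟨_, ⟨n₀, u₀, V₀, a, hn₀, hu₀, hV₀, hach, rfl⟩, hlt⟩ :=
    exists_lt_of_lt_csSup ⟨_, mem_gainRatios⟩ (show c - 0.0005 < c by linarith)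
  have hn₀' : (0 : ℝ) < n₀ := by exact_mod_cast hn₀
  rw [lt_div_iff₀ (by positivity)] at hlt
  -- The cube makes the normalization grow by exactly 1.02. A factor near 1 loses little against the
  -- derivative.
  set v := 1.02 ^ 3 * σ with hv
  have hv0 : 0 < v := by positivity
  have hev := hach.eventually hn₀ hu₀ hV₀ hv0 hV (by norm_num at hc0 ⊢; linarith) hlt
  set Q := (σ * V ^ 2) ^ (1 / 3 : ℝ) with hQ
  have hQ0 : 0 < Q := by positivity
  have hlog := tendsto_log_div_rpow.eventually_lt_const
    (show (0 : ℝ) < 0.0005 * Q / (2 * σ) by positivity)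
  filter_upwards [hev, hlog, eventually_ge_atTop 1] with n hn hl hn1
  obtain ⟨R, hR, hle⟩ := hn
  refine ⟨R, hR, ?_⟩
  have hn0 : (0 : ℝ) < n := by exact_mod_cast hn1
  set D := (n * σ * V ^ 2 : ℝ) ^ (1 / 3 : ℝ) with hD
  have hDQ : D = (n : ℝ) ^ (1 / 3 : ℝ) * Q := by
    rw [hD, hQ, mul_assoc, Real.mul_rpow (by positivity) (by positivity)]
  have hD0 : 0 < D := by positivity
  have hDv : (n * v * V ^ 2 : ℝ) ^ (1 / 3 : ℝ) = 1.02 * D := by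
    have e : (n * v * V ^ 2 : ℝ) = 1.02 ^ 3 * (n * σ * V ^ 2) := by rw [hv]; ring
    rw [e, Real.mul_rpow (by positivity) (by positivity), ← Real.rpow_natCast,
      ← Real.rpow_mul (by norm_num)]
    norm_num
    rfl
  have hnorm : (n : ℝ) ^ (1 / 3 : ℝ) * σ ^ (4 / 3 : ℝ) * V ^ (2 / 3 : ℝ) = σ * D := by
    have e1 : σ ^ (4 / 3 : ℝ) = σ * σ ^ (1 / 3 : ℝ) := by
      rw [show (4 / 3 : ℝ) = 1 + 1 / 3 by norm_num, Real.rpow_add hσ, Real.rpow_one]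
    have e2 : (V ^ 2) ^ (1 / 3 : ℝ) = V ^ (2 / 3 : ℝ) := by
      rw [← Real.rpow_natCast, ← Real.rpow_mul hV.le]; norm_num
    rw [hDQ, hQ, Real.mul_rpow hσ.le (by positivity), e1, e2]; ring
  have hm := isModel_antitoneCone hR.1
  have hmb := isModel_boxCone hR
  have h1 : (c - 0.0005) * (1.02 * D) ≤ meanGain (antitoneCone n) R v := by
    rw [← hDv]
    exact hle.trans (hmb.meanGain_mono_set hm (boxCone_subset n V) hv0)
  have h2 : meanGain (boxCone n V) R σ ≤ c * D := by
    rw [← div_le_iff₀ hD0]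
    exact le_csSup bddAbove_gainRatios ⟨n, σ, V, _, hn1, hσ, hV, ⟨R, hR, le_rfl⟩, rfl⟩
  have h3 := meanGain_antitoneCone_le hn1 hR hσ
  have h4 : 2 * (σ * (2 + Real.log n)) ≤ 0.0005 * D := by
    rw [div_lt_iff₀ (by positivity)] at hl
    calc 2 * (σ * (2 + Real.log n)) ≤
          2 * (σ * (0.0005 * Q / (2 * σ) * (n : ℝ) ^ (1 / 3 : ℝ))) := by gcongr
      _ = 0.0005 * D := by rw [hDQ]; field_simp
  have h5 := hm.meanGain_le_add_risk hσ hv0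
  have e5 : (v - σ) / (2 * σ ^ 2) = 0.030604 / σ := by rw [hv]; field_simp; norm_num
  rw [e5] at h5
  -- `0.00101` is `0.0005 * 1.02` from near-attainment of `c` plus `0.0005` for the logarithm. With
  -- `c ≥ 58.6 / 85` the left side is at least `0.01277 D`, and `0.01277 / 0.030604 > 0.4096`.
  have h6 : (0.02 * c - 0.00101) * D ≤ 0.030604 / σ * risk (antitoneCone n) R σ := by
    linarith
  rw [div_mul_eq_mul_div, le_div_iff₀ hσ] at h6
  rw [hnorm]
  have h7 : 0.01277 ≤ 0.02 * c - 0.00101 := by norm_num at hc0 ⊢; linarith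
  have h8 : 0.01277 * (σ * D) ≤ (0.02 * c - 0.00101) * (σ * D) := by gcongr
  have h9 : 0 < σ * D := by positivity
  norm_num at *
  linarith

/-- The remainder in the upper bound on the normalized risk. -/
def upperRemainder (σ V : ℝ) (n : ℕ) : ℝ :=
  2 * σ ^ 2 * (2 * (V / σ) + 1) / (σ * V) / ((n : ℝ) * σ / V) ^ (1 / 3 : ℝ) +
    8 * σ ^ 2 / (σ * V) / √(((n : ℝ) * σ / V) ^ (1 / 3 : ℝ))

theorem tendsto_upperRemainder {σ V : ℝ} (hσ : 0 < σ) (hV : 0 < V) :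
    Tendsto (upperRemainder σ V) atTop (𝓝 0) := by
  have hx : Tendsto (fun n : ℕ => ((n : ℝ) * σ / V) ^ (1 / 3 : ℝ)) atTop atTop :=
    (tendsto_rpow_atTop (by norm_num)).comp
      ((tendsto_natCast_atTop_atTop.atTop_mul_const hσ).atTop_div_const hV)
  have h := (tendsto_const_nhds (x := 2 * σ ^ 2 * (2 * (V / σ) + 1) / (σ * V))).div_atTop hx |>.add
    ((tendsto_const_nhds (x := 8 * σ ^ 2 / (σ * V))).div_atTop (Real.tendsto_sqrt_atTop.comp hx))
  rw [add_zero] at h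
  exact h

/-- With `N = ⌈x²⌉`, both `n / N` and `√N V / σ` are at most `x V / σ` up to lower order, so the
leading constant is `2 * (1 + 2) = 6`. The remainder collects the rounding and the logarithm. -/
theorem risk_le_upperRemainder {σ V : ℝ} (hσ : 0 < σ) (hV : 0 < V) {n : ℕ} (hn : 1 ≤ n)
    {R : EuclideanSpace ℝ (Fin n)} (hR : R ∈ antitoneCone n) (hRV : ∀ i j, R i - R j ≤ V) :
    risk (antitoneCone n) R σ ≤ (6 + upperRemainder σ V n) *
      ((n : ℝ) ^ (1 / 3 : ℝ) * σ ^ (4 / 3 : ℝ) * V ^ (2 / 3 : ℝ)) := by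
  have hn0 : (0 : ℝ) < n := by exact_mod_cast hn
  unfold upperRemainder
  set x := ((n : ℝ) * σ / V) ^ (1 / 3 : ℝ) with hx
  have hx0 : 0 < x := by positivity
  have hx3 : x ^ 3 = n * σ / V := by
    rw [hx, ← Real.rpow_natCast, ← Real.rpow_mul (by positivity)]; norm_num
  have hnorm : (n : ℝ) ^ (1 / 3 : ℝ) * σ ^ (4 / 3 : ℝ) * V ^ (2 / 3 : ℝ) = σ * V * x := by
    have e1 : σ ^ (4 / 3 : ℝ) = σ * σ ^ (1 / 3 : ℝ) := by
      rw [show (4 / 3 : ℝ) = 1 + 1 / 3 by norm_num, Real.rpow_add hσ, Real.rpow_one]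
    have e2 : V ^ (2 / 3 : ℝ) = V / V ^ (1 / 3 : ℝ) := by
      rw [show (2 / 3 : ℝ) = 1 - 1 / 3 by norm_num, Real.rpow_sub hV, Real.rpow_one]
    rw [hx, Real.div_rpow (by positivity) hV.le, Real.mul_rpow hn0.le hσ.le, e1, e2]
    ring
  set N := ⌈x ^ 2⌉₊ with hN
  have hN1 : 1 ≤ N := Nat.one_le_iff_ne_zero.2 (Nat.ceil_pos.2 (by positivity)).ne'
  have hN0 : (0 : ℝ) < N := by exact_mod_cast hN1
  have hNle : x ^ 2 ≤ N := Nat.le_ceil _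
  have hNlt : (N : ℝ) < x ^ 2 + 1 := Nat.ceil_lt_add_one (by positivity)
  have hnN : (n : ℝ) / N ≤ V / σ * x := by
    have e : (n : ℝ) = V / σ * x ^ 3 := by rw [hx3]; field_simp
    rw [div_le_iff₀ hN0]
    calc (n : ℝ) = V / σ * x * x ^ 2 := by rw [e]; ring
      _ ≤ _ := by gcongr
  have hsq : √(N : ℝ) ≤ x + 1 := Real.sqrt_le_iff.2 ⟨by positivity, by nlinarith⟩
  -- A crude bound, sufficient since only `log N = o(x)` is needed.
  have hlog : Real.log N ≤ 4 * √x := by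
    have hs := Real.sq_sqrt hx0.le
    have hs0 := Real.sqrt_nonneg x
    have h1 : (N : ℝ) ≤ (1 + √x) ^ 4 := by
      have : x ^ 2 = √x ^ 4 := by rw [← hs]; ring_nf; rw [Real.sq_sqrt hx0.le]
      nlinarith [pow_nonneg hs0 3, pow_nonneg hs0 2]
    calc Real.log N ≤ Real.log ((1 + √x) ^ 4) := Real.log_le_log hN0 h1
      _ = 4 * Real.log (1 + √x) := by rw [Real.log_pow]; norm_num
      _ ≤ 4 * √x := by
          have := Real.log_le_sub_one_of_pos (show 0 < 1 + √x by positivity)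
          linarith
  refine (risk_le hR hRV hV.le hσ hN1).trans ?_
  have hb : (n : ℝ) / N + (1 + Real.log N) + 2 * √N * (V / σ) ≤
      V / σ * x + (1 + 4 * √x) + 2 * (x + 1) * (V / σ) := by gcongr
  rw [hnorm]
  have hsx : 0 < √x := Real.sqrt_pos.2 hx0
  calc 2 * σ ^ 2 * ((n : ℝ) / N + (1 + Real.log N) + 2 * √N * (V / σ))
      ≤ 2 * σ ^ 2 * (V / σ * x + (1 + 4 * √x) + 2 * (x + 1) * (V / σ)) := by gcongr
    _ = (6 + (2 * σ ^ 2 * (2 * (V / σ) + 1) / (σ * V) / x + 8 * σ ^ 2 / (σ * V) / √x)) *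
        (σ * V * x) := by
      have e : 8 * σ ^ 2 / (σ * V) / √x * (σ * V * x) = 8 * σ ^ 2 * √x := by
        have := Real.sq_sqrt hx0.le
        field_simp
        linarith
      rw [add_mul, add_mul, e]
      field_simp
      ring

/-- Relabelling of the coordinates. -/
def relabel {n : ℕ} (π : Equiv.Perm (Fin n)) :
    EuclideanSpace ℝ (Fin n) ≃ₗᵢ[ℝ] EuclideanSpace ℝ (Fin n) :=
  LinearIsometryEquiv.piLpCongrLeft 2 ℝ ℝ π.symm

theorem relabel_apply {n : ℕ} (π : Equiv.Perm (Fin n)) (r : EuclideanSpace ℝ (Fin n)) (i : Fin n) :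
    relabel π r i = r (π i) := by
  simp [relabel, LinearIsometryEquiv.piLpCongrLeft]

theorem isProj_relabel {n : ℕ} {π : Equiv.Perm (Fin n)} {y r : EuclideanSpace ℝ (Fin n)}
    (h : IsOptimal π y r) : IsProj (antitoneCone n) (relabel π y) (relabel π r) := by
  have hmem : ∀ {s}, s ∈ isotonicCone π ↔ relabel π s ∈ antitoneCone n := fun {s} => by
    simp only [antitoneCone, isotonicCone, Set.mem_ofPred_eq, relabel_apply]
  have hr := hmem.1 h.1
  refine ⟨hr, ?_⟩
  rw [← norm_eq_iInf_iff_real_inner_le_zero (isModel_antitoneCone hr).convex hr]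
  have : Nonempty (antitoneCone n) := ⟨⟨_, hr⟩⟩
  refine le_antisymm (le_ciInf fun w => ?_)
    (ciInf_le ⟨0, by rintro _ ⟨w, rfl⟩; exact norm_nonneg _⟩ (⟨_, hr⟩ : antitoneCone n))
  obtain ⟨s, hs⟩ := (relabel π).surjective w.1
  have hopt := h.2 s (hmem.2 (hs ▸ w.2))
  rw [← hs, ← map_sub, ← map_sub, LinearIsometryEquiv.norm_map, LinearIsometryEquiv.norm_map]
  exact le_of_sq_le_sq (by linarith) (norm_nonneg _)

end Main

/-! ### From the mechanism with its ranking to the standardized projection problem -/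

section Reduction

variable {n : ℕ} {Ω : Type*} {z : Fin n → Ω → ℝ} {σ : ℝ}

theorem relabel_mem {π : Equiv.Perm (Fin n)} {R : EuclideanSpace ℝ (Fin n)}
    (h : IsTrueRanking π R) : relabel π R ∈ antitoneCone n := fun i j hij => by
  rw [relabel_apply, relabel_apply]; exact h i j hij

/-- The standardized noise in the order of the ranking. -/
def stdNoise (z : Fin n → Ω → ℝ) (σ : ℝ) (π : Equiv.Perm (Fin n)) (ω : Ω) :
    EuclideanSpace ℝ (Fin n) :=
  WithLp.toLp 2 fun i => σ⁻¹ * z (π i) ω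

theorem squaredError_eq (hσ : 0 < σ) {π : Equiv.Perm (Fin n)} {R : EuclideanSpace ℝ (Fin n)}
    (h : IsTrueRanking π R) (ω : Ω) :
    squaredError z π R ω = ‖dev (antitoneCone n) (relabel π R) σ (stdNoise z σ π ω)‖ ^ 2 := by
  have hp := isProj_relabel (isotonicMechanism_isOptimal π (rawScores z R ω))
  have e : relabel π (rawScores z R ω) = relabel π R + σ • stdNoise z σ π ω := by
    ext i
    rw [relabel_apply, PiLp.add_apply, relabel_apply]
    simp [rawScores, stdNoise, hσ.ne']
  rw [e] at hp
  rw [dev, ((isModel_antitoneCone (relabel_mem h)).isProj_proj _).unique hp, ← map_sub,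
    LinearIsometryEquiv.norm_map, EuclideanSpace.real_norm_sq_eq, squaredError]
  rfl

/-- Any two sorted rearrangements of the same values coincide, so ties in the choice of ranking do
no harm. -/
theorem relabel_eq_self {π : Equiv.Perm (Fin n)} {R : EuclideanSpace ℝ (Fin n)}
    (h : IsTrueRanking π R) (hR : R ∈ antitoneCone n) : relabel π R = R := by
  have h1 : Monotone ((fun i => -R i) ∘ π) := fun i j hij => neg_le_neg (h i j hij)
  have h2 : Monotone ((fun i => -R i) ∘ (1 : Equiv.Perm (Fin n))) := fun i j hij =>
    neg_le_neg (hR i j hij)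
  have e := (Tuple.comp_sort_eq_comp_iff_monotone.2 h1).trans
    (Tuple.comp_sort_eq_comp_iff_monotone.2 h2).symm
  ext i
  rw [relabel_apply]
  simpa using congrFun e i

theorem sub_le_of_totalVariation_le {π : Equiv.Perm (Fin n)} {R : EuclideanSpace ℝ (Fin n)}
    (h : IsTrueRanking π R) {V : ℝ} (hV : totalVariation π R ≤ V) (i j : Fin n) :
    R i - R j ≤ V := by
  rw [totalVariation_eq h] at hV
  have h1 := le_ciSup (f := fun i => R i) (Set.finite_range _).bddAbove i
  have h2 := ciInf_le (f := fun i => R i) (Set.finite_range _).bddBelow j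
  linarith

theorem totalVariation_le_of_mem_boxCone (hn : 1 ≤ n) {π : Equiv.Perm (Fin n)}
    {R : EuclideanSpace ℝ (Fin n)} (h : IsTrueRanking π R) {V : ℝ} (hR : R ∈ boxCone n V) :
    totalVariation π R ≤ V := by
  have : Nonempty (Fin n) := ⟨⟨0, by omega⟩⟩
  rw [totalVariation_eq h]
  have h1 : (⨆ i, R i) ≤ V := ciSup_le fun i => (hR.2 i).2
  have h2 : 0 ≤ ⨅ i, R i := le_ciInf fun i => (hR.2 i).1
  linarith

variable [MeasurableSpace Ω] {P : Measure Ω} [IsProbabilityMeasure P]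

theorem map_stdNoise (hσ : 0 < σ) (hind : iIndepFun z P)
    (hlaw : ∀ i, HasLaw (z i) (gaussianReal 0 ⟨σ ^ 2, sq_nonneg σ⟩) P) (π : Equiv.Perm (Fin n)) :
    P.map (stdNoise z σ π) = stdGaussian (EuclideanSpace ℝ (Fin n)) ∧
      AEMeasurable (stdNoise z σ π) P := by
  have hmeas : ∀ i, AEMeasurable (fun ω => σ⁻¹ * z (π i) ω) P := fun i =>
    (hlaw (π i)).aemeasurable.const_mul _
  have hmap : ∀ i, P.map (fun ω => σ⁻¹ * z (π i) ω) = gaussianReal 0 1 := fun i => by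
    have h1 : P.map (fun ω => σ⁻¹ * z (π i) ω) = (P.map (z (π i))).map (σ⁻¹ * ·) := by
      rw [AEMeasurable.map_map_of_aemeasurable (by fun_prop) (hlaw (π i)).aemeasurable]
      rfl
    rw [h1, (hlaw (π i)).map_eq]
    refine (gaussianReal_map_const_mul σ⁻¹).trans ?_
    rw [mul_zero]
    congr 1
    refine NNReal.eq ?_
    change σ⁻¹ ^ 2 * σ ^ 2 = 1
    field_simp
  have hind' : iIndepFun (fun i ω => σ⁻¹ * z (π i) ω) P :=
    (hind.precomp π.injective).comp (fun _ x => σ⁻¹ * x) fun _ => by fun_prop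
  have hpi := (iIndepFun_iff_map_fun_eq_pi_map hmeas).1 hind'
  simp_rw [hmap] at hpi
  have hfun : AEMeasurable (fun ω i => σ⁻¹ * z (π i) ω) P := aemeasurable_pi_lambda _ hmeas
  have htoLp : Measurable (WithLp.toLp 2 : (Fin n → ℝ) → EuclideanSpace ℝ (Fin n)) := by fun_prop
  refine ⟨?_, htoLp.comp_aemeasurable hfun⟩
  rw [← map_pi_eq_stdGaussian, ← hpi,
    AEMeasurable.map_map_of_aemeasurable htoLp.aemeasurable hfun]
  rfl

theorem integrable_squaredError (hσ : 0 < σ) (hind : iIndepFun z P)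
    (hlaw : ∀ i, HasLaw (z i) (gaussianReal 0 ⟨σ ^ 2, sq_nonneg σ⟩) P)
    {π : Equiv.Perm (Fin n)} {R : EuclideanSpace ℝ (Fin n)} (h : IsTrueRanking π R) :
    Integrable (squaredError z π R) P := by
  obtain ⟨hmap, hmeas⟩ := map_stdNoise hσ hind hlaw π
  have hinteg := (isModel_antitoneCone (relabel_mem h)).integrable_dev_sq hσ.le
  rw [← hmap] at hinteg
  refine (hinteg.comp_aemeasurable hmeas).congr (ae_of_all _ fun ω => ?_)
  exact (squaredError_eq hσ h ω).symm

theorem integral_squaredError (hσ : 0 < σ) (hind : iIndepFun z P)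
    (hlaw : ∀ i, HasLaw (z i) (gaussianReal 0 ⟨σ ^ 2, sq_nonneg σ⟩) P)
    {π : Equiv.Perm (Fin n)} {R : EuclideanSpace ℝ (Fin n)} (h : IsTrueRanking π R) :
    ∫ ω, squaredError z π R ω ∂P = risk (antitoneCone n) (relabel π R) σ := by
  obtain ⟨hmap, hmeas⟩ := map_stdNoise hσ hind hlaw π
  have hinteg := (isModel_antitoneCone (relabel_mem h)).integrable_dev_sq hσ.le
  rw [risk, ← hmap, integral_map hmeas (by rw [hmap]; exact hinteg.aestronglyMeasurable)]
  exact integral_congr_ae (ae_of_all _ fun ω => squaredError_eq hσ h ω)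

end Reduction

end IsotonicMechanism

end

open IsotonicMechanism in
theorem theorem3 (σ V : ℝ) (hσ : 0 < σ) (hV : 0 < V) :
    ∃ a b : ℕ → ℝ, Tendsto a atTop (𝓝 0) ∧ Tendsto b atTop (𝓝 0) ∧
      ∀ (n : ℕ), 1 ≤ n →
      ∀ (Ω : Type*) [MeasurableSpace Ω] (P : Measure Ω) [IsProbabilityMeasure P]
        (z : Fin n → Ω → ℝ), iIndepFun z P →
        (∀ i, HasLaw (z i) (gaussianReal 0 ⟨σ ^ 2, sq_nonneg σ⟩) P) →
      ∀ πstar : EuclideanSpace ℝ (Fin n) → Equiv.Perm (Fin n),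
        (∀ R, IsTrueRanking (πstar R) R) →
        -- the expectations and the supremum are those of integrable, bounded quantities
        (∀ R, Integrable (squaredError z (πstar R) R) P) ∧
        BddAbove (Set.range fun R : {R : EuclideanSpace ℝ (Fin n) //
          totalVariation (πstar R) R ≤ V} => ∫ ω, squaredError z (πstar R) R ω ∂P) ∧
        0.4096 + a n ≤ worstCaseRisk P z πstar V /
          ((n : ℝ) ^ (1 / 3 : ℝ) * σ ^ (4 / 3 : ℝ) * V ^ (2 / 3 : ℝ)) ∧
        worstCaseRisk P z πstar V /
          ((n : ℝ) ^ (1 / 3 : ℝ) * σ ^ (4 / 3 : ℝ) * V ^ (2 / 3 : ℝ)) ≤ 7.5625 + b n := by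
  obtain ⟨n₁, hn₁⟩ := eventually_atTop.1 (eventually_le_risk hσ hV)
  -- Below the threshold the remainder makes the lower bound zero, which nonnegativity of the risk
  -- settles.
  refine ⟨fun n => if n₁ ≤ n then 0 else -0.4096, upperRemainder σ V, ?_,
    tendsto_upperRemainder hσ hV, ?_⟩
  · refine tendsto_const_nhds.congr' ?_
    filter_upwards [eventually_ge_atTop n₁] with n hn
    rw [if_pos hn]
  intro n hn Ω _ P _ z hind hlaw πstar hπ
  have hn0 : (0 : ℝ) < n := by exact_mod_cast hn
  have hpos : 0 < (n : ℝ) ^ (1 / 3 : ℝ) * σ ^ (4 / 3 : ℝ) * V ^ (2 / 3 : ℝ) := by positivity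
  have hval := fun R => integral_squaredError hσ hind hlaw (hπ R)
  have hmodel := fun R => isModel_antitoneCone (relabel_mem (hπ R))
  have hbdd : BddAbove (Set.range fun R : {R : EuclideanSpace ℝ (Fin n) //
      totalVariation (πstar R) R ≤ V} => ∫ ω, squaredError z (πstar R) R ω ∂P) := by
    refine ⟨σ ^ 2 * Module.finrank ℝ (EuclideanSpace ℝ (Fin n)), ?_⟩
    rintro _ ⟨R, rfl⟩
    simp only [hval]
    exact (hmodel R).risk_le_finrank hσ.le
  refine ⟨fun R => integrable_squaredError hσ hind hlaw (hπ R), hbdd, ?_, ?_⟩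
  · rw [le_div_iff₀ hpos]
    by_cases hle : n₁ ≤ n
    · simp only [if_pos hle, add_zero]
      obtain ⟨R, hR, hrisk⟩ := hn₁ n hle
      refine hrisk.trans ?_
      have h := le_ciSup hbdd ⟨R, totalVariation_le_of_mem_boxCone hn (hπ R) hR⟩
      simp only [hval, relabel_eq_self (hπ R) hR.1] at h
      simpa only [worstCaseRisk, hval] using h
    · simp only [if_neg hle, add_neg_cancel, zero_mul]
      exact Real.iSup_nonneg fun R => integral_nonneg fun ω =>
        Finset.sum_nonneg fun i _ => sq_nonneg _
  · rw [div_le_iff₀ hpos]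
    have : Nonempty {R : EuclideanSpace ℝ (Fin n) // totalVariation (πstar R) R ≤ V} :=
      ⟨⟨0, totalVariation_le_of_mem_boxCone hn (hπ 0)
        ⟨fun i j _ => le_rfl, fun i => ⟨le_rfl, hV.le⟩⟩⟩⟩
    refine ciSup_le fun R => ?_
    rw [hval]
    refine (risk_le_upperRemainder hσ hV hn (relabel_mem (hπ R)) fun i j => ?_).trans ?_
    · rw [relabel_apply, relabel_apply]
      exact sub_le_of_totalVariation_le (hπ R) R.2 _ _
    -- All that is left is `6 ≤ 7.5625`.
    · gcongr
      norm_num
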